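/- Let $(M,g)$ be a smooth Lorentzian manifold of dimension $n\ge 2$ and signature $(n-1,1)$ with Levi-Civita connection $\nabla$ and curvature operator $R$, and let $V\subset M$ be a (smoothly immersed) lightlike hypersurface, i.e. each tangent hyperplane $T_xV$ contains a nonzero vector orthogonal to $T_xV$. For an isotropic 2-plane $\sigma\subset T_xV$, a nonzero isotropic vector $N\in\sigma$ and a nonisotropic vector $P\in\sigma$ put $K_N(\sigma)=\dfrac{(R(P,N)N,P)}{(P,P)}$ (isotropic sectional curvature). Consider smooth local isotropic frame fields $e_1,e_a,e_n$ ($a=2,\dots,n-1$) along $V$: $e_1,e_a$ are tangent to $V$, $(e_1,e_1)=(e_n,e_n)=(e_1,e_a)=(e_n,e_a)=0$, $(e_1,e_n)=-1$, and $g_{ab}=(e_a,e_b)$ is positive definite. Let $\omega^i$ be the dual coframe, $\nabla e_i=\omega_i^j e_j$, let the components $R^i_{jkl}$, antisymmetric in $k,l$, be given by $d\omega^i_j=\omega_j^k\wedge\omega_k^i+R^i_{jkl}\,\omega^k\wedge\omega^l$ (sum over all $k,l$, so $R(e_k,e_l)e_j=2R^i_{jkl}e_i$), and let $\lambda_{ab}=\omega_a^n(e_b)$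 be the second fundamental tensor of $V$. Put $\nabla\lambda_{ab}=d\lambda_{ab}-\lambda_{ac}\omega_b^c-\lambda_{cb}\omega_a^c$. In every such frame the derivative of the second fundamental tensor along the isotropic direction field is $$(\nabla\lambda_{ab}-\lambda_{ab}\,\omega_1^1)(e_1)=-\lambda_{ac}g^{ce}\lambda_{eb}-2R^n_{ab1},$$ where the first term on the right depends only on the second-order quantities $g_{ab},\lambda_{ab}$. The following conditions are equivalent: (i) $V$ has null isotropic sectional curvature: $K_N(\sigma)=0$ for all isotropic 2-planes $\sigma$ tangent to $V$; (ii) the derivative of the second fundamental tensor along the isotropic direction field is given by its second-order part alone: in every isotropic frame field, $(\nabla\lambda_{ab}-\lambda_{ab}\,\omega_1^1)(e_1)=-\lambda_{ac}g^{ce}\lambda_{eb}$ for all $a,b$; (iii) $R^n_{ab1}=0$ for all $a,b$ in every isotropic frame field along $V$. -/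

import Mathlib

open scoped Manifold ContDiff

noncomputable section

/-! Ambient dimension: `n = m + 2`. The frame indices `1, a, n` with `a = 2, …, n - 1` are
`0`, `midIdx a` with `a : Fin m`, and `Fin.last (m + 1)` in `Fin (m + 2)`. -/

/-- A smooth metric of Lorentzian signature `(n - 1, 1)` on the manifold `M`, `n = m + 2`. -/
structure LorentzMetric (m : ℕ) (M : Type*) [TopologicalSpace M]
    [ChartedSpace (EuclideanSpace ℝ (Fin (m + 2))) M]
    [IsManifold (𝓡 (m + 2)) ∞ M] where
  /-- The scalar product on each tangent space. -/
  val (x : M) : TangentSpace (𝓡 (m + 2)) x →L[ℝ] TangentSpace (𝓡 (m + 2)) x →L[ℝ] ℝ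
  symm (x : M) (v w : TangentSpace (𝓡 (m + 2)) x) : val x v w = val x w v
  signature (x : M) : ∃ b : Module.Basis (Fin (m + 2)) ℝ (TangentSpace (𝓡 (m + 2)) x),
    ∀ i j, val x (b i) (b j) = if i = j then (if i = 0 then -1 else 1) else 0
  contMDiff : ContMDiff (𝓡 (m + 2))
    ((𝓡 (m + 2)).prod 𝓘(ℝ, EuclideanSpace ℝ (Fin (m + 2)) →L[ℝ]
      EuclideanSpace ℝ (Fin (m + 2)) →L[ℝ] ℝ)) ∞
    (fun x ↦ Bundle.TotalSpace.mk' (EuclideanSpace ℝ (Fin (m + 2)) →L[ℝ]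
      EuclideanSpace ℝ (Fin (m + 2)) →L[ℝ] ℝ) x (val x))

section Ambient

variable {m : ℕ} {M : Type*} [TopologicalSpace M]
  [ChartedSpace (EuclideanSpace ℝ (Fin (m + 2))) M] [IsManifold (𝓡 (m + 2)) ∞ M]

/-- `D` is the Levi-Civita connection of `g`: a smooth connection on `TM`, torsion-free and
compatible with `g`. Mathlib's argument order is `D Y x v = (∇_v Y)(x)`. -/
structure IsLeviCivita (g : LorentzMetric m M)
    (D : CovariantDerivative (𝓡 (m + 2)) (EuclideanSpace ℝ (Fin (m + 2)))
      (TangentSpace (𝓡 (m + 2)) : M → Type _)) : Prop where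
  smooth : CovariantDerivative.ContMDiffCovariantDerivative D ∞
  torsion_eq_zero : D.torsion = 0
  compatible : ∀ (x : M) (Y Z : Π y : M, TangentSpace (𝓡 (m + 2)) y),
    MDifferentiableAt (𝓡 (m + 2)) (𝓡 (m + 2)).tangent
      (fun y ↦ (⟨y, Y y⟩ : TangentBundle (𝓡 (m + 2)) M)) x →
    MDifferentiableAt (𝓡 (m + 2)) (𝓡 (m + 2)).tangent
      (fun y ↦ (⟨y, Z y⟩ : TangentBundle (𝓡 (m + 2)) M)) x →
    ∀ v : TangentSpace (𝓡 (m + 2)) x,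
      mvfderiv (𝓡 (m + 2)) (fun y ↦ g.val y (Y y) (Z y)) x v =
        g.val x (D Y x v) (Z x) + g.val x (Y x) (D Z x v)

/-- The curvature operator `R(u, v) w = ∇_X ∇_Y Z - ∇_Y ∇_X Z - ∇_{[X, Y]} Z` at `x`, where
`X, Y, Z` are the extensions of `u, v, w` that are constant in a local trivialization of `TM`
around `x`. -/
def curvature
    (D : CovariantDerivative (𝓡 (m + 2)) (EuclideanSpace ℝ (Fin (m + 2)))
      (TangentSpace (𝓡 (m + 2)) : M → Type _))
    (x : M) (u v w : TangentSpace (𝓡 (m + 2)) x) : TangentSpace (𝓡 (m + 2)) x :=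
  let X : Π y : M, TangentSpace (𝓡 (m + 2)) y :=
    FiberBundle.extend (EuclideanSpace ℝ (Fin (m + 2))) u
  let Y : Π y : M, TangentSpace (𝓡 (m + 2)) y :=
    FiberBundle.extend (EuclideanSpace ℝ (Fin (m + 2))) v
  let Z : Π y : M, TangentSpace (𝓡 (m + 2)) y :=
    FiberBundle.extend (EuclideanSpace ℝ (Fin (m + 2))) w
  D (fun y ↦ D Z y (Y y)) x u - D (fun y ↦ D Z y (X y)) x v
    - D Z x (VectorField.mlieBracket (𝓡 (m + 2)) X Y x)

/-- A 2-plane of `T_x M` is isotropic if it is tangent to the isotropic cone, that is, if it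
contains a nonzero vector orthogonal to the whole plane. -/
def IsIsotropicPlane (g : LorentzMetric m M) (x : M)
    (σ : Submodule ℝ (TangentSpace (𝓡 (m + 2)) x)) : Prop :=
  Module.finrank ℝ σ = 2 ∧ ∃ N ∈ σ, N ≠ 0 ∧ ∀ w ∈ σ, g.val x N w = 0

/-- Isotropic sectional curvature `K_N(σ) = (R(P, N) N, P) / (P, P)` of the isotropic plane `σ`
spanned by the isotropic vector `N` and the nonisotropic vector `P`. -/
def isotropicSectionalCurvature (g : LorentzMetric m M)
    (D : CovariantDerivative (𝓡 (m + 2)) (EuclideanSpace ℝ (Fin (m + 2)))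
      (TangentSpace (𝓡 (m + 2)) : M → Type _))
    (x : M) (N P : TangentSpace (𝓡 (m + 2)) x) : ℝ :=
  g.val x (curvature D x P N N) P / g.val x P P

end Ambient

section Hypersurface

variable {m : ℕ} {M : Type*} [TopologicalSpace M]
  [ChartedSpace (EuclideanSpace ℝ (Fin (m + 2))) M] [IsManifold (𝓡 (m + 2)) ∞ M]
  {V : Type*} [TopologicalSpace V]
  [ChartedSpace (EuclideanSpace ℝ (Fin (m + 1))) V]

/-- The tangent hyperplane of the hypersurface `ι : V → M` at `p`, as a subspace of `T_{ι p} M`. -/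
def tangentHyperplane (ι : V → M) (p : V) : Submodule ℝ (TangentSpace (𝓡 (m + 2)) (ι p)) :=
  (mfderiv (𝓡 (m + 1)) (𝓡 (m + 2)) ι p).range

/-- An immersed hypersurface is lightlike if each tangent hyperplane is tangent to the isotropic
cone, that is, contains a nonzero vector orthogonal to the whole hyperplane. -/
structure IsLightlikeHypersurface (g : LorentzMetric m M) (ι : V → M) : Prop where
  isImmersion : Manifold.IsImmersion (𝓡 (m + 1)) (𝓡 (m + 2)) ∞ ι
  lightlike : ∀ p : V, ∃ N ∈ tangentHyperplane ι p, N ≠ 0 ∧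
    ∀ w ∈ tangentHyperplane ι p, g.val (ι p) N w = 0

/-- The hypersurface has null isotropic sectional curvature: `K_N(σ) = 0` for all isotropic
2-planes `σ` tangent to it. -/
def HasNullIsotropicSectionalCurvature (g : LorentzMetric m M)
    (D : CovariantDerivative (𝓡 (m + 2)) (EuclideanSpace ℝ (Fin (m + 2)))
      (TangentSpace (𝓡 (m + 2)) : M → Type _)) (ι : V → M) : Prop :=
  ∀ (p : V) (σ : Submodule ℝ (TangentSpace (𝓡 (m + 2)) (ι p))),
    σ ≤ tangentHyperplane ι p → IsIsotropicPlane g (ι p) σ →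
    ∀ N ∈ σ, N ≠ 0 → g.val (ι p) N N = 0 → ∀ P ∈ σ, g.val (ι p) P P ≠ 0 →
      isotropicSectionalCurvature g D (ι p) N P = 0

/-- The frame index `a ∈ {2, …, n - 1}`. -/
def midIdx {m : ℕ} (a : Fin m) : Fin (m + 2) := a.succ.castSucc

/-- A smooth first-order isotropic frame field `e_1, e_a, e_n` along the open part `W` of the
hypersurface: `e_1, e_a` are tangent to it, and the scalar products at its points are
`(e_1, e_1) = (e_n, e_n) = (e_1, e_a) = (e_n, e_a) = 0`, `(e_1, e_n) = -1`, with `(e_a, e_b)`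
positive definite. The vector fields are defined on a neighbourhood `U` of `ι '' W` in `M`, so that
the connection of `M` applies to them; nothing but smoothness and linear independence is required
off the hypersurface. -/
structure IsotropicFrame (g : LorentzMetric m M) (ι : V → M) (W : Set V) where
  isOpen_dom : IsOpen W
  /-- A neighbourhood of `ι '' W` on which the vector fields are defined. -/
  U : Set M
  isOpen_U : IsOpen U
  mapsTo : Set.MapsTo ι W U
  /-- The frame vectors. -/
  e : Fin (m + 2) → Π x : M, TangentSpace (𝓡 (m + 2)) x
  isLocalFrame : IsLocalFrameOn (𝓡 (m + 2)) (EuclideanSpace ℝ (Fin (m + 2))) ∞ e U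
  first_mem : ∀ p ∈ W, e 0 (ι p) ∈ tangentHyperplane ι p
  mid_mem : ∀ p ∈ W, ∀ a : Fin m, e (midIdx a) (ι p) ∈ tangentHyperplane ι p
  first_first : ∀ p ∈ W, g.val (ι p) (e 0 (ι p)) (e 0 (ι p)) = 0
  last_last : ∀ p ∈ W,
    g.val (ι p) (e (Fin.last (m + 1)) (ι p)) (e (Fin.last (m + 1)) (ι p)) = 0
  first_last : ∀ p ∈ W, g.val (ι p) (e 0 (ι p)) (e (Fin.last (m + 1)) (ι p)) = -1
  first_mid : ∀ p ∈ W, ∀ a : Fin m, g.val (ι p) (e 0 (ι p)) (e (midIdx a) (ι p)) = 0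
  last_mid : ∀ p ∈ W, ∀ a : Fin m,
    g.val (ι p) (e (Fin.last (m + 1)) (ι p)) (e (midIdx a) (ι p)) = 0
  posDef : ∀ p ∈ W, (Matrix.of fun a b : Fin m ↦
    g.val (ι p) (e (midIdx a) (ι p)) (e (midIdx b) (ι p))).PosDef

namespace IsotropicFrame

variable {g : LorentzMetric m M} {ι : V → M} {W : Set V}

/-- The coframe form `ω^j` at the point `ι p`. -/
def coframe (F : IsotropicFrame g ι W) (j : Fin (m + 2)) (p : V) :
    TangentSpace (𝓡 (m + 2)) (ι p) →ₗ[ℝ] ℝ :=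
  F.isLocalFrame.coeff j (ι p)

/-- The matrix `(g_ab)` of the first fundamental form. -/
def firstFundamental (F : IsotropicFrame g ι W) (p : V) : Matrix (Fin m) (Fin m) ℝ :=
  Matrix.of fun a b ↦ g.val (ι p) (F.e (midIdx a) (ι p)) (F.e (midIdx b) (ι p))

variable (D : CovariantDerivative (𝓡 (m + 2)) (EuclideanSpace ℝ (Fin (m + 2)))
      (TangentSpace (𝓡 (m + 2)) : M → Type _))

/-- The connection form `ω_i^j` restricted to the hypersurface (`∇ e_i = ω_i^j e_j`), evaluated on
`X ∈ T_p V`. -/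
def connectionForm (F : IsotropicFrame g ι W) (i j : Fin (m + 2)) (p : V)
    (X : TangentSpace (𝓡 (m + 1)) p) : ℝ :=
  F.coframe j p (D (F.e i) (ι p) (mfderiv (𝓡 (m + 1)) (𝓡 (m + 2)) ι p X))

/-- The second fundamental tensor `λ_ab`, the coefficients in `ω_a^n = λ_ab ω^b`, that is,
`λ_ab = ω_a^n(e_b)`. -/
def secondFundamental (F : IsotropicFrame g ι W) (p : V) : Matrix (Fin m) (Fin m) ℝ :=
  Matrix.of fun a b ↦
    F.coframe (Fin.last (m + 1)) p (D (F.e (midIdx a)) (ι p) (F.e (midIdx b) (ι p)))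

/-- The 1-form `∇λ_ab - λ_ab ω_1^1` on the hypersurface, evaluated on `X ∈ T_p V`, where
`∇λ_ab = dλ_ab - λ_ac ω_b^c - λ_cb ω_a^c`. -/
def covDerivSecondFundamental (F : IsotropicFrame g ι W) (p : V)
    (X : TangentSpace (𝓡 (m + 1)) p) : Matrix (Fin m) (Fin m) ℝ :=
  Matrix.of fun a b ↦
    mvfderiv (𝓡 (m + 1)) (fun q : V ↦ F.secondFundamental D q a b) p X
      - ∑ c, F.secondFundamental D p a c * F.connectionForm D (midIdx b) (midIdx c) p X
      - ∑ c, F.secondFundamental D p c b * F.connectionForm D (midIdx a) (midIdx c) p X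
      - F.secondFundamental D p a b * F.connectionForm D 0 0 p X

/-- The curvature components `R^i_{jkl}`, antisymmetric in `k, l`, given by the structure equations
`dω_j^i = ω_j^k ∧ ω_k^i + R^i_{jkl} ω^k ∧ ω^l` with summation over all `k, l`; in terms of the
curvature operator, `R(e_k, e_l) e_j = 2 R^i_{jkl} e_i`. -/
def curvatureComponent (F : IsotropicFrame g ι W) (p : V) (i j k l : Fin (m + 2)) : ℝ :=
  F.coframe i p (curvature D (ι p) (F.e k (ι p)) (F.e l (ι p)) (F.e j (ι p))) / 2

/-- The matrix `(R^n_{ab1})`. -/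
def curvatureTerm (F : IsotropicFrame g ι W) (p : V) : Matrix (Fin m) (Fin m) ℝ :=
  Matrix.of fun a b ↦
    F.curvatureComponent D p (Fin.last (m + 1)) (midIdx a) (midIdx b) 0

end IsotropicFrame

/-- The expression `- λ_ac g^{ce} λ_eb` in the elements `g_ab`, `λ_ab` of the second-order
neighbourhood of a point of the hypersurface. -/
def secondOrderExpression (G L : Matrix (Fin m) (Fin m) ℝ) : Matrix (Fin m) (Fin m) ℝ :=
  -(L * G⁻¹ * L)

end Hypersurface

end

/-! Since (e_1, e_n) = -1, the second fundamental tensor is a scalar product: λ_ab = -(∇_{e_b} e_a,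
e_1). Its derivative along e_1 contains (∇_{e_1} ∇_{e_b} e_a, e_1). On the other hand [e_1, e_a] is
tangent to the hypersurface, hence orthogonal to e_1, and (∇_{e_a} e_1, e_1) = 0; so (∇_{e_1} e_a,
e_1) vanishes along the hypersurface, and its derivative along e_b expresses (∇_{e_b} ∇_{e_1} e_a,
e_1) by first derivatives. The two second derivatives differ by (R(e_1, e_b) e_a, e_1) = 2 R^n_{ab1}
and a term in ∇_{[e_1, e_b]} e_a. In [e_1, e_b] = ∇_{e_1} e_b - ∇_{e_b} e_1 the e_c-component of
∇_{e_b} e_1 is g^{ce} λ_eb, which yields -λ_ac g^{ce} λ_eb; everything else is absorbed by the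
connection terms of ∇λ_ab - λ_ab ω_1^1. This is `IsotropicFrame.covDerivSecondFundamental_eq`, and
it makes (ii) and (iii) equivalent.

Isotropic tangent vectors are multiples of e_1, and for N = e_1, P = t e_1 + x^a e_a the numerator
of K_N is 2 R^n_{ab1} x^a x^b. So (i) says that this quadratic form vanishes. As R^n_{ab1} is
symmetric in a, b (`curvatureTerm_symm`), polarization gives (iii). The converse needs an isotropic
frame at every point: `IsLightlikeHypersurface.exists_isotropicFrame` builds one from the gradient
of a local defining function.

The groundwork is the action of a bracket on functions, the tensoriality and skew-symmetries of the
curvature, and the tangency of brackets of tangent fields. -/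

noncomputable section

open Filter Topology VectorField FiberBundle

/-! ### Germs of smooth functions and fields, brackets and covariant derivatives -/

section SmoothNear

variable {m : ℕ} {M : Type*} [TopologicalSpace M]
  [ChartedSpace (EuclideanSpace ℝ (Fin (m + 2))) M]

variable (m) in
/-- The function `f` is smooth on a neighbourhood of `x`. -/
def FunSmoothNear (f : M → ℝ) (x : M) : Prop :=
  ∀ᶠ y in 𝓝 x, ContMDiffAt (𝓡 (m + 2)) 𝓘(ℝ, ℝ) ∞ f y

variable {x : M} {f f' : M → ℝ}

namespace FunSmoothNear

lemma mdifferentiableAt (hf : FunSmoothNear m f x) :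
    MDifferentiableAt (𝓡 (m + 2)) 𝓘(ℝ, ℝ) f x :=
  hf.self_of_nhds.mdifferentiableAt (by simp)

/-- `ContMDiffAt` of order `∞` at one point need not persist at nearby points. Asking for a whole
neighbourhood makes the condition open, so identities between germs can be differentiated again. -/
lemma eventually (hf : FunSmoothNear m f x) : ∀ᶠ y in 𝓝 x, FunSmoothNear m f y :=
  hf.eventually_nhds

lemma const (c : ℝ) : FunSmoothNear m (fun _ : M ↦ c) x :=
  Eventually.of_forall fun _ ↦ contMDiffAt_const

lemma mul (hf : FunSmoothNear m f x) (hf' : FunSmoothNear m f' x) :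
    FunSmoothNear m (fun y ↦ f y * f' y) x := by
  filter_upwards [hf, hf'] with y hy hy' using hy.mul hy'

lemma neg (hf : FunSmoothNear m f x) : FunSmoothNear m (fun y ↦ - f y) x := by
  filter_upwards [hf] with y hy using hy.neg

lemma sum {ι : Type*} {s : Finset ι} {F : ι → M → ℝ}
    (h : ∀ i ∈ s, FunSmoothNear m (F i) x) : FunSmoothNear m (fun y ↦ ∑ i ∈ s, F i y) x := by
  have h' : ∀ᶠ y in 𝓝 x, ∀ i ∈ s, ContMDiffAt (𝓡 (m + 2)) 𝓘(ℝ, ℝ) ∞ (F i) y :=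
    (Filter.eventually_all_finset s).2 h
  filter_upwards [h'] with y hy using contMDiffAt_finsetSum hy

lemma prod {ι : Type*} {s : Finset ι} {F : ι → M → ℝ}
    (h : ∀ i ∈ s, FunSmoothNear m (F i) x) : FunSmoothNear m (fun y ↦ ∏ i ∈ s, F i y) x := by
  have h' : ∀ᶠ y in 𝓝 x, ∀ i ∈ s, ContMDiffAt (𝓡 (m + 2)) 𝓘(ℝ, ℝ) ∞ (F i) y :=
    (Filter.eventually_all_finset s).2 h
  filter_upwards [h'] with y hy using contMDiffAt_finsetProd hy

lemma inv (hf : FunSmoothNear m f x) (h0 : f x ≠ 0) : FunSmoothNear m (fun y ↦ (f y)⁻¹) x := by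
  have hc : ContinuousAt f x := hf.self_of_nhds.continuousAt
  filter_upwards [hf, hc.eventually_ne h0] with y hy hy' using hy.inv₀ hy'

end FunSmoothNear

variable [IsManifold (𝓡 (m + 2)) ∞ M]

/-- The vector field `X` is smooth on a neighbourhood of `x`. -/
def FieldSmoothNear (X : Π y : M, TangentSpace (𝓡 (m + 2)) y) (x : M) : Prop :=
  ∀ᶠ y in 𝓝 x, ContMDiffAt (𝓡 (m + 2)) (𝓡 (m + 2)).tangent ∞
    (fun y ↦ (⟨y, X y⟩ : TangentBundle (𝓡 (m + 2)) M)) y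

variable {X Y Z : Π y : M, TangentSpace (𝓡 (m + 2)) y}

namespace FieldSmoothNear

lemma mdifferentiableAt (hX : FieldSmoothNear X x) :
    MDifferentiableAt (𝓡 (m + 2)) (𝓡 (m + 2)).tangent
      (fun y ↦ (⟨y, X y⟩ : TangentBundle (𝓡 (m + 2)) M)) x :=
  hX.self_of_nhds.mdifferentiableAt (by simp)

lemma eventually (hX : FieldSmoothNear X x) : ∀ᶠ y in 𝓝 x, FieldSmoothNear X y :=
  hX.eventually_nhds

lemma congr (hX : FieldSmoothNear X x) (h : ∀ᶠ y in 𝓝 x, X y = Y y) : FieldSmoothNear Y x := by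
  filter_upwards [hX, h.eventually_nhds] with y hy hy'
  exact hy.congr_of_eventuallyEq (hy'.mono fun z hz ↦ by simp [hz])

lemma add (hX : FieldSmoothNear X x) (hY : FieldSmoothNear Y x) :
    FieldSmoothNear (X + Y) x := by
  filter_upwards [hX, hY] with y hy hy' using hy.add_section hy'

lemma sub (hX : FieldSmoothNear X x) (hY : FieldSmoothNear Y x) :
    FieldSmoothNear (X - Y) x := by
  filter_upwards [hX, hY] with y hy hy' using hy.sub_section hy'

lemma smul (hf : FunSmoothNear m f x) (hX : FieldSmoothNear X x) :
    FieldSmoothNear (f • X) x := by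
  filter_upwards [hf, hX] with y hy hy' using hy.smul_section hy'

lemma sum {ι : Type*} {s : Finset ι} {F : ι → Π y : M, TangentSpace (𝓡 (m + 2)) y}
    (h : ∀ i ∈ s, FieldSmoothNear (F i) x) : FieldSmoothNear (fun y ↦ ∑ i ∈ s, F i y) x := by
  have h' := (Filter.eventually_all_finset s).2 h
  filter_upwards [h'] with y hy using ContMDiffAt.sum_section hy

variable (m) in
lemma extend (v : TangentSpace (𝓡 (m + 2)) x) :
    FieldSmoothNear (FiberBundle.extend (EuclideanSpace ℝ (Fin (m + 2))) v) x := by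
  obtain ⟨s, hs, h⟩ := exists_contMDiffOn_extend (k := ∞) (𝓡 (m + 2))
    (EuclideanSpace ℝ (Fin (m + 2))) v
  filter_upwards [eventually_mem_nhds_iff.2 hs] with y hy using h.contMDiffAt hy

lemma mlieBracket (hX : FieldSmoothNear X x) (hY : FieldSmoothNear Y x) :
    FieldSmoothNear (mlieBracket (𝓡 (m + 2)) X Y) x := by
  have : IsManifold (𝓡 (m + 2)) (((⊤ : ℕ∞) : ℕ∞ω) + 1) M := by simpa
  have : IsManifold (𝓡 (m + 2)) (minSmoothness ℝ 2) M :=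
    IsManifold.of_le (n := ∞) (by simpa using ENat.LEInfty.out)
  filter_upwards [hX, hY] with y hy hy'
  exact ContMDiffAt.mlieBracket_vectorField (m := ⊤) (n := ⊤) hy hy' (by simp)

end FieldSmoothNear

/-- The derivative of a smooth function along a smooth vector field is smooth. -/
lemma FieldSmoothNear.mvfderiv (hX : FieldSmoothNear X x) (hf : FunSmoothNear m f x) :
    FunSmoothNear m (fun y ↦ mvfderiv (𝓡 (m + 2)) f y (X y)) x := by
  have : IsManifold (𝓡 (m + 2)) (minSmoothness ℝ 2) M :=
    IsManifold.of_le (n := ∞) (by simpa using ENat.LEInfty.out)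
  let t := trivializationAt (EuclideanSpace ℝ (Fin (m + 2)))
    (TangentSpace (𝓡 (m + 2)) : M → Type _) x
  let b := (EuclideanSpace.basisFun (Fin (m + 2)) ℝ).toBasis
  have ht : t.baseSet ∈ 𝓝 x :=
    t.open_baseSet.mem_nhds (FiberBundle.mem_baseSet_trivializationAt' x)
  have hW : FieldSmoothNear (t.localFrame b 0) x := by
    filter_upwards [ht] with y hy using contMDiffAt_localFrame_of_mem _ t b 0 hy
  -- For a member W of a local frame, [X, fW] - f [X, W] = X(f) W, so X(f) is a frame coefficient of
  -- a smooth field.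
  have h1 : FieldSmoothNear
      (VectorField.mlieBracket (𝓡 (m + 2)) X (f • t.localFrame b 0)
        - f • VectorField.mlieBracket (𝓡 (m + 2)) X (t.localFrame b 0)) x :=
    (hX.mlieBracket (hW.smul hf)).sub ((hX.mlieBracket hW).smul hf)
  filter_upwards [h1, ht, hf.eventually, hW.eventually, hf.eventually_nhds,
    hW.eventually_nhds, eventually_mem_nhds_iff.2 ht] with y hy hyt hfy hWy hfy' hWy' hyt'
  refine (contMDiffAt_localFrameCoeff b hyt hy 0).congr_of_eventuallyEq ?_
  filter_upwards [hfy', hWy', hyt'] with z hfz hWz hzt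
  simp only [LinearMap.piApply_apply, Pi.sub_apply, Pi.smul_apply',
    mlieBracket_smul_right (hfz.mdifferentiableAt (by simp)) (hWz.mdifferentiableAt (by simp)),
    add_sub_cancel_right, map_smul]
  rw [t.localFrameCoeff_apply_of_mem_baseSet b hzt]
  simp [hzt]

/-- The Lie bracket acts on functions as the commutator of derivations. -/
lemma mvfderiv_mlieBracket (hX : FieldSmoothNear X x) (hY : FieldSmoothNear Y x)
    (hf : FunSmoothNear m f x) :
    mvfderiv (𝓡 (m + 2)) f x (mlieBracket (𝓡 (m + 2)) X Y x) =
      mvfderiv (𝓡 (m + 2)) (fun y ↦ mvfderiv (𝓡 (m + 2)) f y (Y y)) x (X x) -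
        mvfderiv (𝓡 (m + 2)) (fun y ↦ mvfderiv (𝓡 (m + 2)) f y (X y)) x (Y x) := by
  have : IsManifold (𝓡 (m + 2)) (minSmoothness ℝ 2) M :=
    IsManifold.of_le (n := ∞) (by simpa using ENat.LEInfty.out)
  have : IsManifold (𝓡 (m + 2)) (minSmoothness ℝ 3) M :=
    IsManifold.of_le (n := ∞) (by simpa using ENat.LEInfty.out)
  have key {A B : Π y : M, TangentSpace (𝓡 (m + 2)) y} {h : M → ℝ} {y : M}
      (hB : FieldSmoothNear B y) (hh : FunSmoothNear m h y) :
      mlieBracket (𝓡 (m + 2)) A (h • B) y = mvfderiv (𝓡 (m + 2)) h y (A y) • B y +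
        h y • mlieBracket (𝓡 (m + 2)) A B y :=
    mlieBracket_smul_right hh.mdifferentiableAt hB.mdifferentiableAt
  obtain ⟨w, hw⟩ : ∃ w : TangentSpace (𝓡 (m + 2)) x, w ≠ 0 :=
    ⟨(EuclideanSpace.single 0 1 : EuclideanSpace ℝ (Fin (m + 2))),
      (by simp : (EuclideanSpace.single (0 : Fin (m + 2)) (1 : ℝ)) ≠ 0)⟩
  set W : Π y : M, TangentSpace (𝓡 (m + 2)) y :=
    FiberBundle.extend (EuclideanSpace ℝ (Fin (m + 2))) w with hWdef
  have hWx : W x = w := FiberBundle.extend_apply_self _ _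
  have hW : FieldSmoothNear W x := .extend m w
  have hle : minSmoothness ℝ 2 ≤ ∞ := by simpa using ENat.LEInfty.out
  have expand {A B : Π y : M, TangentSpace (𝓡 (m + 2)) y} (hA : FieldSmoothNear A x)
      (hB : FieldSmoothNear B x) :
      mlieBracket (𝓡 (m + 2)) A (mlieBracket (𝓡 (m + 2)) B (f • W)) x =
        mvfderiv (𝓡 (m + 2)) (fun y ↦ mvfderiv (𝓡 (m + 2)) f y (B y)) x (A x) • w
        + mvfderiv (𝓡 (m + 2)) f x (B x) • mlieBracket (𝓡 (m + 2)) A W x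
        + mvfderiv (𝓡 (m + 2)) f x (A x) • mlieBracket (𝓡 (m + 2)) B W x
        + f x • mlieBracket (𝓡 (m + 2)) A (mlieBracket (𝓡 (m + 2)) B W) x := by
    have h1 : mlieBracket (𝓡 (m + 2)) B (f • W) =ᶠ[𝓝 x]
        (fun y ↦ mvfderiv (𝓡 (m + 2)) f y (B y)) • W + f • mlieBracket (𝓡 (m + 2)) B W := by
      filter_upwards [hW.eventually, hf.eventually] with y hy hy'
      exact key hy hy'
    rw [EventuallyEq.rfl.mlieBracket_vectorField_eq h1,
      mlieBracket_add_right (hW.smul (hB.mvfderiv hf)).mdifferentiableAt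
        ((hB.mlieBracket hW).smul hf).mdifferentiableAt,
      key hW (hB.mvfderiv hf), key (hB.mlieBracket hW) hf, hWx]
    abel
  -- Compare the Jacobi identities of X, Y, fW and of X, Y, W. The mixed terms are symmetric in X
  -- and Y and cancel; what remains is the claim times w ≠ 0.
  have jac := leibniz_identity_mlieBracket_apply (hX.self_of_nhds.of_le hle)
    (hY.self_of_nhds.of_le hle) ((hW.smul hf).self_of_nhds.of_le hle)
  have jac' := leibniz_identity_mlieBracket_apply (hX.self_of_nhds.of_le hle)
    (hY.self_of_nhds.of_le hle) (hW.self_of_nhds.of_le hle)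
  rw [expand hX hY, expand hY hX, key hW hf, jac', hWx] at jac
  have h2 : (mvfderiv (𝓡 (m + 2)) f x (mlieBracket (𝓡 (m + 2)) X Y x) -
      (mvfderiv (𝓡 (m + 2)) (fun y ↦ mvfderiv (𝓡 (m + 2)) f y (Y y)) x (X x) -
        mvfderiv (𝓡 (m + 2)) (fun y ↦ mvfderiv (𝓡 (m + 2)) f y (X y)) x (Y x))) • w = 0 := by
    linear_combination (norm := module) (-1 : ℝ) • jac
  exact sub_eq_zero.1 ((smul_eq_zero.1 h2).resolve_right hw)

variable {g : LorentzMetric m M}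

lemma FieldSmoothNear.metric (hX : FieldSmoothNear X x) (hY : FieldSmoothNear Y x) :
    FunSmoothNear m (fun y ↦ g.val y (X y) (Y y)) x := by
  filter_upwards [hX, hY] with y hy hy'
  have := ContMDiffAt.clm_bundle_apply₂ (F₃ := ℝ) (E₃ := Bundle.Trivial M ℝ)
    (g.contMDiff.contMDiffAt (x := y)) hy hy'
  simpa [Bundle.contMDiffAt_section] using this

variable {D : CovariantDerivative (𝓡 (m + 2)) (EuclideanSpace ℝ (Fin (m + 2)))
      (TangentSpace (𝓡 (m + 2)) : M → Type _)}

lemma CovariantDerivative.congr_of_eventually (hY : FieldSmoothNear Y x)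
    (h : ∀ᶠ y in 𝓝 x, Y y = Z y) : D Y x = D Z x :=
  D.isCovariantDerivativeOn.congr_of_eventuallyEq hY.mdifferentiableAt
    (hY.congr h).mdifferentiableAt univ_mem h

/-- Smoothness of a connection is applied to globally smooth sections, so a germ is first cut off by
a bump function. -/
lemma FieldSmoothNear.exists_global [T2Space M] (hX : FieldSmoothNear X x) :
    ∃ Y : Π y : M, TangentSpace (𝓡 (m + 2)) y,
      (∀ y, ContMDiffAt (𝓡 (m + 2)) (𝓡 (m + 2)).tangent ∞
        (fun y ↦ (⟨y, Y y⟩ : TangentBundle (𝓡 (m + 2)) M)) y) ∧ ∀ᶠ y in 𝓝 x, X y = Y y := by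
  obtain ⟨χ, -, hχ⟩ := (SmoothBumpFunction.nhds_basis_tsupport (I := 𝓡 (m + 2)) x).mem_iff.1 hX
  refine ⟨(χ : M → ℝ) • X, fun y ↦ ?_, ?_⟩
  · by_cases hy : y ∈ tsupport χ
    · exact χ.contMDiffAt.smul_section (hχ hy)
    · have h0 : χ =ᶠ[𝓝 y] 0 := notMem_tsupport_iff_eventuallyEq.1 hy
      refine (Bundle.contMDiff_zeroSection ℝ
        (TangentSpace (𝓡 (m + 2)) : M → Type _)).contMDiffAt.congr_of_eventuallyEq ?_
      filter_upwards [h0] with z hz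
      simp [hz, Bundle.zeroSection]
  · filter_upwards [χ.eventuallyEq_one] with y hy
    simp [hy]

lemma FieldSmoothNear.covHom [T2Space M]
    (hD : CovariantDerivative.ContMDiffCovariantDerivative D ∞) (hZ : FieldSmoothNear Z x) :
    ∀ᶠ y in 𝓝 x, ContMDiffAt (𝓡 (m + 2)) ((𝓡 (m + 2)).prod
      𝓘(ℝ, EuclideanSpace ℝ (Fin (m + 2)) →L[ℝ] EuclideanSpace ℝ (Fin (m + 2)))) ∞
      (fun y ↦ Bundle.TotalSpace.mk' (EuclideanSpace ℝ (Fin (m + 2)) →L[ℝ]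
        EuclideanSpace ℝ (Fin (m + 2))) (E := fun y : M ↦ TangentSpace (𝓡 (m + 2)) y →L[ℝ]
          TangentSpace (𝓡 (m + 2)) y) y (D Z y)) y := by
  obtain ⟨Z', hZ', h⟩ := hZ.exists_global
  have h1 := hD.contMDiff.contMDiff (σ := Z')
    (fun y _ ↦ by simpa using (hZ' y).contMDiffWithinAt)
  filter_upwards [h.eventually_nhds, hZ.eventually.eventually_nhds] with y hy hy'
  refine (h1.contMDiffAt univ_mem).congr_of_eventuallyEq ?_
  filter_upwards [eventually_eventually_nhds.2 hy, hy'] with z hz hz'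
  exact congrArg _ (CovariantDerivative.congr_of_eventually hz' hz)

lemma FieldSmoothNear.cov [T2Space M] (hD : CovariantDerivative.ContMDiffCovariantDerivative D ∞)
    (hZ : FieldSmoothNear Z x) (hX : FieldSmoothNear X x) :
    FieldSmoothNear (fun y ↦ D Z y (X y)) x := by
  filter_upwards [hX, hZ.covHom hD] with y hy hy' using hy'.clm_bundle_apply hy

/-- `TensorialAt` tests fields X that are merely differentiable at the point, hence this weaker
version of `FieldSmoothNear.cov`. -/
lemma FieldSmoothNear.mdifferentiableAt_cov [T2Space M]
    (hD : CovariantDerivative.ContMDiffCovariantDerivative D ∞)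
    (hZ : FieldSmoothNear Z x) (hX : MDifferentiableAt (𝓡 (m + 2)) (𝓡 (m + 2)).tangent
      (fun y ↦ (⟨y, X y⟩ : TangentBundle (𝓡 (m + 2)) M)) x) :
    MDifferentiableAt (𝓡 (m + 2)) (𝓡 (m + 2)).tangent
      (fun y ↦ (⟨y, D Z y (X y)⟩ : TangentBundle (𝓡 (m + 2)) M)) x :=
  ((hZ.covHom hD).self_of_nhds.mdifferentiableAt (by simp)).clm_bundle_apply hX

end SmoothNear

/-! ### Tensoriality and skew-symmetries of the curvature -/

section Curvature

variable {m : ℕ} {M : Type*} [TopologicalSpace M]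
  [ChartedSpace (EuclideanSpace ℝ (Fin (m + 2))) M] [IsManifold (𝓡 (m + 2)) ∞ M]
  {g : LorentzMetric m M}
  {D : CovariantDerivative (𝓡 (m + 2)) (EuclideanSpace ℝ (Fin (m + 2)))
      (TangentSpace (𝓡 (m + 2)) : M → Type _)}
  {x : M} {f f' : M → ℝ} {X X' Y Y' Z Z' W : Π y : M, TangentSpace (𝓡 (m + 2)) y}

omit [IsManifold (𝓡 (m + 2)) ∞ M] in
lemma mvfderiv_congr (h : f =ᶠ[𝓝 x] f') :
    mvfderiv (𝓡 (m + 2)) f x = mvfderiv (𝓡 (m + 2)) f' x := by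
  ext v
  exact congrArg (fun A : TangentSpace (𝓡 (m + 2)) x →L[ℝ] ℝ ↦ A v)
    (h.mfderiv_eq (I := 𝓡 (m + 2)) (I' := 𝓘(ℝ, ℝ)))

/-- Nondegeneracy: pairing with a vector of an orthonormal basis returns a coordinate up to sign. -/
lemma LorentzMetric.eq_of_forall_val_eq (g : LorentzMetric m M)
    {v w : TangentSpace (𝓡 (m + 2)) x} (h : ∀ u, g.val x v u = g.val x w u) : v = w := by
  obtain ⟨b, hb⟩ := g.signature x
  refine b.ext_elem fun i ↦ ?_
  have key (u : TangentSpace (𝓡 (m + 2)) x) :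
      g.val x u (b i) = b.repr u i * (if i = 0 then -1 else 1) := by
    conv_lhs => rw [← b.sum_repr u]
    simp only [map_sum, map_smul, sum_apply, smul_apply,
      hb, smul_eq_mul]
    simp
  have := h (b i)
  rw [key, key] at this
  refine mul_right_cancel₀ ?_ this
  split_ifs <;> norm_num

lemma IsLeviCivita.mvfderiv_metric (hD : IsLeviCivita g D) (hY : FieldSmoothNear Y x)
    (hZ : FieldSmoothNear Z x) (v : TangentSpace (𝓡 (m + 2)) x) :
    mvfderiv (𝓡 (m + 2)) (fun y ↦ g.val y (Y y) (Z y)) x v =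
      g.val x (D Y x v) (Z x) + g.val x (Y x) (D Z x v) :=
  hD.compatible x Y Z hY.mdifferentiableAt hZ.mdifferentiableAt v

lemma IsLeviCivita.mlieBracket_eq (hD : IsLeviCivita g D) (hX : FieldSmoothNear X x)
    (hY : FieldSmoothNear Y x) :
    mlieBracket (𝓡 (m + 2)) X Y x = D Y x (X x) - D X x (Y x) :=
  (D.torsion_eq_zero_iff.1 hD.torsion_eq_zero hX.mdifferentiableAt hY.mdifferentiableAt).symm

variable (D) in
/-- The curvature `∇_X ∇_Y Z - ∇_Y ∇_X Z - ∇_{[X, Y]} Z` of three vector fields. -/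
def curvatureField (X Y Z : Π y : M, TangentSpace (𝓡 (m + 2)) y) (x : M) :
    TangentSpace (𝓡 (m + 2)) x :=
  D (fun y ↦ D Z y (Y y)) x (X x) - D (fun y ↦ D Z y (X y)) x (Y x)
    - D Z x (mlieBracket (𝓡 (m + 2)) X Y x)

lemma curvatureField_swap : curvatureField D X Y Z x = - curvatureField D Y X Z x := by
  rw [curvatureField, curvatureField, mlieBracket_swap_apply, map_neg]
  abel

lemma curvature_swap (u v w : TangentSpace (𝓡 (m + 2)) x) :
    curvature D x u v w = - curvature D x v u w := by
  simpa [curvatureField, curvature] using curvatureField_swap (D := D) (x := x)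
    (X := FiberBundle.extend (EuclideanSpace ℝ (Fin (m + 2))) u)
    (Y := FiberBundle.extend (EuclideanSpace ℝ (Fin (m + 2))) v)
    (Z := FiberBundle.extend (EuclideanSpace ℝ (Fin (m + 2))) w)

variable [T2Space M]

/-- Apply XY - YX = [X, Y] to the function (Z, W) and expand by metric compatibility; the products
of first derivatives are symmetric in X, Y and cancel. -/
lemma IsLeviCivita.val_curvatureField_antisymm (hD : IsLeviCivita g D) (hX : FieldSmoothNear X x)
    (hY : FieldSmoothNear Y x) (hZ : FieldSmoothNear Z x) (hW : FieldSmoothNear W x) :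
    g.val x (curvatureField D X Y Z x) (W x) = - g.val x (Z x) (curvatureField D X Y W x) := by
  have second {A B : Π y : M, TangentSpace (𝓡 (m + 2)) y} (hA : FieldSmoothNear A x)
      (hB : FieldSmoothNear B x) :
      mvfderiv (𝓡 (m + 2))
        (fun y ↦ mvfderiv (𝓡 (m + 2)) (fun y ↦ g.val y (Z y) (W y)) y (B y)) x (A x) =
      g.val x (D (fun y ↦ D Z y (B y)) x (A x)) (W x)
        + g.val x (D Z x (B x)) (D W x (A x))
        + g.val x (D Z x (A x)) (D W x (B x))
        + g.val x (Z x) (D (fun y ↦ D W y (B y)) x (A x)) := by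
    have h : (fun y ↦ mvfderiv (𝓡 (m + 2)) (fun y ↦ g.val y (Z y) (W y)) y (B y)) =ᶠ[𝓝 x]
        (fun y ↦ g.val y (D Z y (B y)) (W y)) + fun y ↦ g.val y (Z y) (D W y (B y)) := by
      filter_upwards [hZ.eventually, hW.eventually] with y hy hy'
      exact hD.mvfderiv_metric hy hy' _
    have hZB := hZ.cov hD.smooth hB
    have hWB := hW.cov hD.smooth hB
    rw [mvfderiv_congr h, mvfderiv_add (hZB.metric hW).mdifferentiableAt
      (hZ.metric hWB).mdifferentiableAt, add_apply,
      hD.mvfderiv_metric hZB hW, hD.mvfderiv_metric hZ hWB]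
    ring
  have h := mvfderiv_mlieBracket hX hY (hZ.metric (g := g) hW)
  rw [second hX hY, second hY hX, hD.mvfderiv_metric hZ hW] at h
  simp only [curvatureField, map_sub, sub_apply]
  linear_combination -h

/-- Replacing X by fX creates -Y(f) ∇_X Z from the second term, which cancels against the -Y(f) X in
[fX, Y]. -/
lemma tensorialAt_curvatureField (hD : IsLeviCivita g D) (hZ : FieldSmoothNear Z x) :
    TensorialAt (𝓡 (m + 2)) (EuclideanSpace ℝ (Fin (m + 2)))
      (fun X ↦ curvatureField D X Y Z x) x where
  smul {f X} hf hX := by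
    have : IsManifold (𝓡 (m + 2)) (minSmoothness ℝ 2) M :=
      IsManifold.of_le (n := ∞) (by simpa using ENat.LEInfty.out)
    have h1 : D (fun y ↦ D Z y ((f • X) y)) x = f x • D (fun y ↦ D Z y (X y)) x +
        (mvfderiv (𝓡 (m + 2)) f x).smulRight (D Z x (X x)) := by
      rw [← D.isCovariantDerivativeOn.leibniz (hZ.mdifferentiableAt_cov hD.smooth hX) hf]
      congr 1
      ext y
      simp
    simp only [curvatureField, h1]
    rw [mlieBracket_smul_left hf hX]
    simp
    module
  add {X X'} hX hX' := by
    have : IsManifold (𝓡 (m + 2)) (minSmoothness ℝ 2) M :=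
      IsManifold.of_le (n := ∞) (by simpa using ENat.LEInfty.out)
    have h1 : D (fun y ↦ D Z y ((X + X') y)) x = D (fun y ↦ D Z y (X y)) x +
        D (fun y ↦ D Z y (X' y)) x := by
      rw [← D.isCovariantDerivativeOn.add (hZ.mdifferentiableAt_cov hD.smooth hX)
        (hZ.mdifferentiableAt_cov hD.smooth hX')]
      congr 1
      ext y
      simp
    simp only [curvatureField, h1]
    rw [mlieBracket_add_left hX hX']
    simp
    module

/-- The curvature at a point depends only on the values of the vector fields at that point. -/
lemma IsLeviCivita.curvatureField_congr (hD : IsLeviCivita g D)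
    (hX : FieldSmoothNear X x) (hX' : FieldSmoothNear X' x)
    (hY : FieldSmoothNear Y x) (hY' : FieldSmoothNear Y' x)
    (hZ : FieldSmoothNear Z x) (hZ' : FieldSmoothNear Z' x)
    (hXX' : X x = X' x) (hYY' : Y x = Y' x) (hZZ' : Z x = Z' x) :
    curvatureField D X Y Z x = curvatureField D X' Y' Z' x := by
  have h1 : curvatureField D X Y Z x = curvatureField D X' Y Z x :=
    (tensorialAt_curvatureField hD hZ).pointwise hX.mdifferentiableAt hX'.mdifferentiableAt hXX'
  have h2 : curvatureField D Y X' Z x = curvatureField D Y' X' Z x :=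
    (tensorialAt_curvatureField hD hZ).pointwise hY.mdifferentiableAt
      hY'.mdifferentiableAt hYY'
  rw [h1, curvatureField_swap, h2, ← curvatureField_swap]
  -- For the third slot no Leibniz computation is needed: skew-symmetry turns (R(X, Y) Z, u) into a
  -- pairing in which Z enters only through its value at x.
  refine g.eq_of_forall_val_eq fun u ↦ ?_
  have hU := FieldSmoothNear.extend m u
  have hu : FiberBundle.extend (EuclideanSpace ℝ (Fin (m + 2))) u x = u :=
    FiberBundle.extend_apply_self _ _
  have h3 := hD.val_curvatureField_antisymm hX' hY' hZ hU
  have h4 := hD.val_curvatureField_antisymm hX' hY' hZ' hU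
  rw [hu] at h3 h4
  rw [h3, h4, hZZ']

lemma IsLeviCivita.curvatureField_eq (hD : IsLeviCivita g D) (hX : FieldSmoothNear X x)
    (hY : FieldSmoothNear Y x) (hZ : FieldSmoothNear Z x) :
    curvatureField D X Y Z x = curvature D x (X x) (Y x) (Z x) := by
  have hu (v : TangentSpace (𝓡 (m + 2)) x) :
      FiberBundle.extend (EuclideanSpace ℝ (Fin (m + 2))) v x = v :=
    FiberBundle.extend_apply_self _ _
  rw [hD.curvatureField_congr hX (.extend m _) hY (.extend m _) hZ (.extend m _)
    (hu _).symm (hu _).symm (hu _).symm]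
  simp [curvatureField, curvature]

lemma IsLeviCivita.val_curvature_antisymm (hD : IsLeviCivita g D)
    (u v w z : TangentSpace (𝓡 (m + 2)) x) :
    g.val x (curvature D x u v w) z = - g.val x (curvature D x u v z) w := by
  have hu (v : TangentSpace (𝓡 (m + 2)) x) :
      FiberBundle.extend (EuclideanSpace ℝ (Fin (m + 2))) v x = v :=
    FiberBundle.extend_apply_self _ _
  have := hD.val_curvatureField_antisymm (.extend m u) (.extend m v) (.extend m w) (.extend m z)
  rwa [hD.curvatureField_eq (.extend m u) (.extend m v) (.extend m w),
    hD.curvatureField_eq (.extend m u) (.extend m v) (.extend m z), hu, hu, hu, hu,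
    g.symm x w] at this

lemma IsLeviCivita.curvature_add_left (hD : IsLeviCivita g D)
    (u u' v w : TangentSpace (𝓡 (m + 2)) x) :
    curvature D x (u + u') v w = curvature D x u v w + curvature D x u' v w := by
  have hu (v : TangentSpace (𝓡 (m + 2)) x) :
      FiberBundle.extend (EuclideanSpace ℝ (Fin (m + 2))) v x = v :=
    FiberBundle.extend_apply_self _ _
  have h := (tensorialAt_curvatureField
    (Y := FiberBundle.extend (EuclideanSpace ℝ (Fin (m + 2))) v) hD (.extend m w)).add
    (FieldSmoothNear.extend m u).mdifferentiableAt (FieldSmoothNear.extend m u').mdifferentiableAt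
  rwa [hD.curvatureField_eq ((FieldSmoothNear.extend m u).add (.extend m u')) (.extend m v)
    (.extend m w), hD.curvatureField_eq (.extend m u) (.extend m v) (.extend m w),
    hD.curvatureField_eq (.extend m u') (.extend m v) (.extend m w), Pi.add_apply,
    hu, hu, hu, hu] at h

lemma IsLeviCivita.curvature_smul_left (hD : IsLeviCivita g D) (c : ℝ)
    (u v w : TangentSpace (𝓡 (m + 2)) x) :
    curvature D x (c • u) v w = c • curvature D x u v w := by
  have hu (v : TangentSpace (𝓡 (m + 2)) x) :
      FiberBundle.extend (EuclideanSpace ℝ (Fin (m + 2))) v x = v :=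
    FiberBundle.extend_apply_self _ _
  have h := (tensorialAt_curvatureField
    (Y := FiberBundle.extend (EuclideanSpace ℝ (Fin (m + 2))) v) hD (.extend m w)).smul
    (FunSmoothNear.const (m := m) (x := x) c).mdifferentiableAt
    (FieldSmoothNear.extend m u).mdifferentiableAt
  rwa [hD.curvatureField_eq ((FieldSmoothNear.extend m u).smul (.const c)) (.extend m v)
    (.extend m w), hD.curvatureField_eq (.extend m u) (.extend m v) (.extend m w),
    Pi.smul_apply', hu, hu, hu] at h

end Curvature

/-! ### Local defining functions and tangent hyperplanes -/

section DefiningFunction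

variable {m : ℕ} {M : Type*} [TopologicalSpace M]
  [ChartedSpace (EuclideanSpace ℝ (Fin (m + 2))) M]
  {V : Type*} [TopologicalSpace V]
  [ChartedSpace (EuclideanSpace ℝ (Fin (m + 1))) V]

lemma mdifferentiable_of_mem_maximalAtlas {k : ℕ} {N : Type*} [TopologicalSpace N]
    [ChartedSpace (EuclideanSpace ℝ (Fin k)) N] [IsManifold (𝓡 k) ∞ N]
    {φ : OpenPartialHomeomorph N (EuclideanSpace ℝ (Fin k))}
    (h : φ ∈ IsManifold.maximalAtlas (𝓡 k) ∞ N) : φ.MDifferentiable (𝓡 k) (𝓡 k) :=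
  ⟨(contMDiffOn_of_mem_maximalAtlas h).mdifferentiableOn (by simp),
    (contMDiffOn_symm_of_mem_maximalAtlas h).mdifferentiableOn (by simp)⟩

variable [IsManifold (𝓡 (m + 2)) ∞ M] [IsManifold (𝓡 (m + 1)) ∞ V]

/-- A hypersurface has, locally, a smooth defining function with nonvanishing differential, and its
differential is injective. -/
lemma Manifold.IsImmersion.exists_definingFunction {ι : V → M}
    (hι : Manifold.IsImmersion (𝓡 (m + 1)) (𝓡 (m + 2)) ∞ ι) (p : V) :
    ∃ f : M → ℝ, FunSmoothNear m f (ι p) ∧ ∀ᶠ q in 𝓝 p, f (ι q) = 0 ∧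
      MDifferentiableAt (𝓡 (m + 1)) (𝓡 (m + 2)) ι q ∧
      Function.Injective (mfderiv (𝓡 (m + 1)) (𝓡 (m + 2)) ι q) ∧
      mvfderiv (𝓡 (m + 2)) f (ι q) ≠ 0 := by
  obtain ⟨C, _, _, hC⟩ := hι
  have H := hC p
  set φ := H.domChart
  set ψ := H.codChart
  have hφ := mdifferentiable_of_mem_maximalAtlas H.domChart_mem_maximalAtlas
  have hψ := mdifferentiable_of_mem_maximalAtlas H.codChart_mem_maximalAtlas
  have hpφ : φ.source ∈ 𝓝 p := φ.open_source.mem_nhds H.mem_domChart_source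
  have hpψ : ψ.source ∈ 𝓝 (ι p) := ψ.open_source.mem_nhds H.mem_codChart_source
  have hchart {q : V} (hq : q ∈ φ.source) : ψ (ι q) = H.equiv (φ q, 0) := by
    have hφq : φ q ∈ (φ.extend (𝓡 (m + 1))).target := by simpa using φ.map_source hq
    have := H.writtenInCharts hφq
    have hinv : H.domChart.symm (φ q) = q := φ.left_inv hq
    simpa [hinv] using this
  -- The complement C of the immersion normal form is nonzero, since the dimensions m + 1 and m + 2
  -- differ.
  obtain ⟨c, hc⟩ : ∃ c : C, c ≠ 0 := by
    by_contra! h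
    let _ : Unique C := ⟨⟨0⟩, h⟩
    have e : EuclideanSpace ℝ (Fin (m + 1)) ≃ₗ[ℝ] EuclideanSpace ℝ (Fin (m + 2)) :=
      ((ContinuousLinearEquiv.prodUnique ℝ _ C).symm.trans H.equiv).toLinearEquiv
    simpa using e.finrank_eq
  obtain ⟨l, -, hl⟩ := exists_dual_vector ℝ c (norm_ne_zero_iff.2 hc)
  -- In the normal form ι is u ↦ (u, 0). A recovers u, which gives injectivity of the differential;
  -- B is a normal coordinate with B (0, c) = ‖c‖, which gives the defining function.
  let A : EuclideanSpace ℝ (Fin (m + 2)) →L[ℝ] EuclideanSpace ℝ (Fin (m + 1)) :=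
    (ContinuousLinearMap.fst ℝ _ _) ∘L (H.equiv.symm : EuclideanSpace ℝ (Fin (m + 2)) →L[ℝ]
      EuclideanSpace ℝ (Fin (m + 1)) × C)
  let B : EuclideanSpace ℝ (Fin (m + 2)) →L[ℝ] ℝ :=
    l ∘L (ContinuousLinearMap.snd ℝ _ _) ∘L (H.equiv.symm : EuclideanSpace ℝ (Fin (m + 2)) →L[ℝ]
      EuclideanSpace ℝ (Fin (m + 1)) × C)
  refine ⟨fun y ↦ B (ψ y), ?_, ?_⟩
  · filter_upwards [hpψ] with y hy
    exact (B.contMDiff (n := ∞)).contMDiffAt.comp y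
      (contMDiffAt_of_mem_maximalAtlas H.codChart_mem_maximalAtlas hy)
  filter_upwards [hpφ, eventually_mem_nhds_iff.2 hpφ] with q hq hq'
  have hqψ : ι q ∈ ψ.source := H.source_subset_preimage_source hq
  have hιq : MDifferentiableAt (𝓡 (m + 1)) (𝓡 (m + 2)) ι q :=
    (H.contMDiffOn.contMDiffAt hq').mdifferentiableAt (by simp)
  refine ⟨by simp [hchart hq, B], hιq, ?_, ?_⟩
  · have h1 : (A ∘ ψ) ∘ ι =ᶠ[𝓝 q] φ := by
      filter_upwards [hq'] with z hz
      simp [hchart hz, A]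
    have hAψ : MDifferentiableAt (𝓡 (m + 2)) (𝓡 (m + 1)) (A ∘ ψ) (ι q) :=
      A.mdifferentiableAt.comp _ (hψ.mdifferentiableAt hqψ)
    have h2 := h1.mfderiv_eq (I := 𝓡 (m + 1)) (I' := 𝓡 (m + 1))
    have h3 := mfderiv_comp q hAψ hιq
    have hinj := hφ.mfderiv_injective hq
    intro v w hvw
    apply hinj
    rw [← h2, h3]
    exact congrArg (mfderiv (𝓡 (m + 2)) (𝓡 (m + 1)) (A ∘ ψ) (ι q)) hvw
  · intro h0
    obtain ⟨v, hv⟩ := hψ.mfderiv_surjective hqψ (H.equiv (0, c))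
    have h1 : mfderiv (𝓡 (m + 2)) 𝓘(ℝ, ℝ) (B ∘ ψ) (ι q) v = B (H.equiv (0, c)) := by
      rw [mfderiv_comp (ι q) B.mdifferentiableAt (hψ.mdifferentiableAt hqψ), B.mfderiv_eq]
      exact congrArg B hv
    have h2 : mfderiv (𝓡 (m + 2)) 𝓘(ℝ, ℝ) (B ∘ ψ) (ι q) v = 0 :=
      congrArg (fun T : TangentSpace (𝓡 (m + 2)) (ι q) →L[ℝ] ℝ ↦ T v) h0
    rw [h1] at h2
    simp [B] at h2
    simp [h2] at hl
    exact hc (norm_eq_zero.1 hl.symm)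

variable {ι : V → M} {p : V}

omit [IsManifold (𝓡 (m + 2)) ∞ M] [IsManifold (𝓡 (m + 1)) ∞ V] in
/-- A function vanishing along a hypersurface has zero derivative in the tangent directions. -/
lemma mvfderiv_eq_zero_of_mem_tangentHyperplane {f : M → ℝ}
    (hι : MDifferentiableAt (𝓡 (m + 1)) (𝓡 (m + 2)) ι p)
    (hf : MDifferentiableAt (𝓡 (m + 2)) 𝓘(ℝ, ℝ) f (ι p)) (h : ∀ᶠ q in 𝓝 p, f (ι q) = 0)
    {v : TangentSpace (𝓡 (m + 2)) (ι p)} (hv : v ∈ tangentHyperplane ι p) :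
    mvfderiv (𝓡 (m + 2)) f (ι p) v = 0 := by
  obtain ⟨X, rfl⟩ := hv
  have h1 : mvfderiv (𝓡 (m + 1)) (f ∘ ι) p X = 0 := by
    have h2 : f ∘ ι =ᶠ[𝓝 p] fun _ ↦ (0 : ℝ) := h
    have h3 := h2.mfderiv_eq (I := 𝓡 (m + 1)) (I' := 𝓘(ℝ, ℝ))
    rw [mfderiv_const] at h3
    exact congrArg (fun T : TangentSpace (𝓡 (m + 1)) p →L[ℝ] ℝ ↦ T X) h3
  rwa [mvfderiv_comp_apply p hf hι] at h1

instance (x : M) : FiniteDimensional ℝ (TangentSpace (𝓡 (m + 2)) x) :=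
  inferInstanceAs (FiniteDimensional ℝ (EuclideanSpace ℝ (Fin (m + 2))))

omit [IsManifold (𝓡 (m + 2)) ∞ M] [IsManifold (𝓡 (m + 1)) ∞ V] in
lemma finrank_tangentSpace (x : M) : Module.finrank ℝ (TangentSpace (𝓡 (m + 2)) x) = m + 2 :=
  finrank_euclideanSpace_fin (𝕜 := ℝ) (n := m + 2)

omit [IsManifold (𝓡 (m + 2)) ∞ M] [IsManifold (𝓡 (m + 1)) ∞ V] in
lemma finrank_tangentHyperplane
    (hι : Function.Injective (mfderiv (𝓡 (m + 1)) (𝓡 (m + 2)) ι p)) :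
    Module.finrank ℝ (tangentHyperplane (m := m) ι p) = m + 1 :=
  (LinearMap.finrank_range_of_inj hι).trans (finrank_euclideanSpace_fin (𝕜 := ℝ) (n := m + 1))

/-- Near each point, the tangent hyperplanes are the kernels of the differential of a defining
function. -/
lemma Manifold.IsImmersion.exists_tangentHyperplane_eq_ker
    (hι : Manifold.IsImmersion (𝓡 (m + 1)) (𝓡 (m + 2)) ∞ ι) (p : V) :
    ∃ f : M → ℝ, FunSmoothNear m f (ι p) ∧
      ∀ᶠ q in 𝓝 p, f (ι q) = 0 ∧ mvfderiv (𝓡 (m + 2)) f (ι q) ≠ 0 ∧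
        ∀ v, v ∈ tangentHyperplane ι q ↔ mvfderiv (𝓡 (m + 2)) f (ι q) v = 0 := by
  obtain ⟨f, hf, h⟩ := hι.exists_definingFunction p
  have hc : ContinuousAt ι p := h.self_of_nhds.2.1.continuousAt
  refine ⟨f, hf, ?_⟩
  filter_upwards [h, h.eventually_nhds, hc.eventually hf.eventually]
    with q ⟨hq0, hq, hinj, hne⟩ hq' hfq
  refine ⟨hq0, hne, ?_⟩
  have hle : tangentHyperplane ι q ≤
      LinearMap.ker (mvfderiv (𝓡 (m + 2)) f (ι q) : TangentSpace (𝓡 (m + 2)) (ι q) →ₗ[ℝ] ℝ) :=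
    fun v hv ↦ mvfderiv_eq_zero_of_mem_tangentHyperplane hq hfq.mdifferentiableAt
      (hq'.mono fun z hz ↦ hz.1) hv
  have heq := Submodule.eq_of_le_of_finrank_eq hle (by
    have h1 := Module.Dual.finrank_ker_add_one_of_ne_zero (K := ℝ)
      (f := (mvfderiv (𝓡 (m + 2)) f (ι q) : TangentSpace (𝓡 (m + 2)) (ι q) →ₗ[ℝ] ℝ))
      (fun h0 ↦ hne (by ext v; exact congrArg (fun T : _ →ₗ[ℝ] ℝ ↦ T v) h0))
    rw [finrank_tangentHyperplane hinj]
    rw [finrank_tangentSpace] at h1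
    omega)
  intro v
  rw [heq]
  simp

/-- The Lie bracket of vector fields tangent to a hypersurface is tangent to it. -/
lemma Manifold.IsImmersion.mlieBracket_mem_tangentHyperplane
    (hι : Manifold.IsImmersion (𝓡 (m + 1)) (𝓡 (m + 2)) ∞ ι)
    {X Y : Π y : M, TangentSpace (𝓡 (m + 2)) y} (hX : FieldSmoothNear X (ι p))
    (hY : FieldSmoothNear Y (ι p)) (hXV : ∀ᶠ q in 𝓝 p, X (ι q) ∈ tangentHyperplane ι q)
    (hYV : ∀ᶠ q in 𝓝 p, Y (ι q) ∈ tangentHyperplane ι q) :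
    mlieBracket (𝓡 (m + 2)) X Y (ι p) ∈ tangentHyperplane ι p := by
  obtain ⟨f, hf, h⟩ := hι.exists_tangentHyperplane_eq_ker p
  have hιp : MDifferentiableAt (𝓡 (m + 1)) (𝓡 (m + 2)) ι p :=
    (hι.contMDiff p).mdifferentiableAt (by simp)
  -- [X, Y] f = X(Y f) - Y(X f), and both Y f and X f vanish along the hypersurface, where X and Y
  -- are tangent.
  rw [h.self_of_nhds.2.2, mvfderiv_mlieBracket hX hY hf,
    mvfderiv_eq_zero_of_mem_tangentHyperplane hιp (hY.mvfderiv hf).mdifferentiableAt ?_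
      hXV.self_of_nhds,
    mvfderiv_eq_zero_of_mem_tangentHyperplane hιp (hX.mvfderiv hf).mdifferentiableAt ?_
      hYV.self_of_nhds, sub_zero]
  · filter_upwards [h, hXV] with q hq hq' using (hq.2.2 _).1 hq'
  · filter_upwards [h, hYV] with q hq hq' using (hq.2.2 _).1 hq'

end DefiningFunction

/-! ### Algebra and first-order relations of an isotropic frame -/

section

lemma sum_univ_eq_first_mid_last {m : ℕ} {A : Type*} [AddCommMonoid A] (f : Fin (m + 2) → A) :
    ∑ i, f i = f 0 + ∑ a : Fin m, f (midIdx a) + f (Fin.last (m + 1)) := by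
  rw [Fin.sum_univ_castSucc, Fin.sum_univ_succ]
  rfl

lemma eq_first_or_mid_or_last {m : ℕ} (i : Fin (m + 2)) :
    i = 0 ∨ (∃ a : Fin m, i = midIdx a) ∨ i = Fin.last (m + 1) := by
  induction i using Fin.lastCases with
  | last => simp
  | cast i =>
    induction i using Fin.cases with
    | zero => simp
    | succ a => exact Or.inr (Or.inl ⟨a, rfl⟩)

namespace IsotropicFrame

variable {m : ℕ} {M : Type*} [TopologicalSpace M]
  [ChartedSpace (EuclideanSpace ℝ (Fin (m + 2))) M] [IsManifold (𝓡 (m + 2)) ∞ M]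
  {V : Type*} [TopologicalSpace V]
  [ChartedSpace (EuclideanSpace ℝ (Fin (m + 1))) V]
  {g : LorentzMetric m M} {ι : V → M} {W : Set V} (F : IsotropicFrame g ι W) {p : V}

section Algebra

include F

lemma fieldSmoothNear (hp : p ∈ W) (i : Fin (m + 2)) : FieldSmoothNear (F.e i) (ι p) := by
  filter_upwards [F.isOpen_U.mem_nhds (F.mapsTo hp)] with y hy
  exact F.isLocalFrame.contMDiffAt F.isOpen_U hy i

lemma coframe_eq (hp : p ∈ W) (i : Fin (m + 2)) :
    F.coframe i p = (F.isLocalFrame.toBasisAt (F.mapsTo hp)).coord i := by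
  simp [coframe, IsLocalFrameOn.coeff, F.mapsTo hp]

lemma sum_coframe (hp : p ∈ W) (v : TangentSpace (𝓡 (m + 2)) (ι p)) :
    ∑ i, F.coframe i p v • F.e i (ι p) = v := by
  simpa [F.coframe_eq hp] using (F.isLocalFrame.toBasisAt (F.mapsTo hp)).sum_repr v

lemma coframe_self (hp : p ∈ W) (i j : Fin (m + 2)) :
    F.coframe j p (F.e i (ι p)) = if i = j then 1 else 0 := by
  have h := (F.isLocalFrame.toBasisAt (F.mapsTo hp)).repr_self_apply i j
  rw [IsLocalFrameOn.toBasisAt_coe] at h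
  simpa [F.coframe_eq hp] using h

/-- Expansion of the scalar product in a frame. -/
lemma val_eq (hp : p ∈ W) (v w : TangentSpace (𝓡 (m + 2)) (ι p)) :
    g.val (ι p) v w = F.coframe 0 p v * g.val (ι p) (F.e 0 (ι p)) w
      + ∑ c, F.coframe (midIdx c) p v * g.val (ι p) (F.e (midIdx c) (ι p)) w
      + F.coframe (Fin.last (m + 1)) p v * g.val (ι p) (F.e (Fin.last (m + 1)) (ι p)) w := by
  conv_lhs => rw [← F.sum_coframe hp v, sum_univ_eq_first_mid_last]
  simp

/-- This turns ω^n into a pairing with e_1, so that metric compatibility applies to λ_ab. The sign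
comes from (e_1, e_n) = -1. -/
lemma val_first (hp : p ∈ W) (v : TangentSpace (𝓡 (m + 2)) (ι p)) :
    g.val (ι p) v (F.e 0 (ι p)) = - F.coframe (Fin.last (m + 1)) p v := by
  rw [F.val_eq hp v, F.first_first p hp, g.symm _ (F.e (Fin.last (m + 1)) (ι p)),
    F.first_last p hp]
  simp_rw [g.symm (ι p) _ (F.e 0 (ι p)), F.first_mid p hp]
  simp

lemma val_last (hp : p ∈ W) (v : TangentSpace (𝓡 (m + 2)) (ι p)) :
    g.val (ι p) v (F.e (Fin.last (m + 1)) (ι p)) = - F.coframe 0 p v := by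
  rw [F.val_eq hp v, F.last_last p hp, F.first_last p hp]
  simp_rw [g.symm (ι p) _ (F.e (Fin.last (m + 1)) (ι p)), F.last_mid p hp]
  simp

lemma val_mid (hp : p ∈ W) (v : TangentSpace (𝓡 (m + 2)) (ι p)) (b : Fin m) :
    g.val (ι p) v (F.e (midIdx b) (ι p)) =
      ∑ c, F.coframe (midIdx c) p v * F.firstFundamental p c b := by
  rw [F.val_eq hp v, F.first_mid p hp, F.last_mid p hp]
  simp [firstFundamental]

lemma firstFundamental_symm (p : V) (a b : Fin m) :
    F.firstFundamental p a b = F.firstFundamental p b a :=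
  g.symm _ _ _

/-- Two tangent vectors with the same scalar products with the frame vectors are equal. -/
lemma eq_of_val_eq (hp : p ∈ W) {v w : TangentSpace (𝓡 (m + 2)) (ι p)}
    (h : ∀ i, g.val (ι p) v (F.e i (ι p)) = g.val (ι p) w (F.e i (ι p))) : v = w := by
  refine g.eq_of_forall_val_eq fun u ↦ ?_
  rw [g.symm _ v, g.symm _ w, F.val_eq hp u, F.val_eq hp u w]
  simp only [g.symm _ _ v, g.symm _ _ w, h]

/-- The tangent hyperplane consists of the vectors without component along the last frame vector. -/
lemma mem_tangentHyperplane_iff (hι : Function.Injective (mfderiv (𝓡 (m + 1)) (𝓡 (m + 2)) ι p))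
    (hp : p ∈ W) {v : TangentSpace (𝓡 (m + 2)) (ι p)} :
    v ∈ tangentHyperplane ι p ↔ F.coframe (Fin.last (m + 1)) p v = 0 := by
  have hle : LinearMap.ker (F.coframe (Fin.last (m + 1)) p) ≤ tangentHyperplane ι p := by
    intro v hv
    rw [← F.sum_coframe hp v, sum_univ_eq_first_mid_last, LinearMap.mem_ker.1 hv, zero_smul,
      add_zero]
    exact add_mem (Submodule.smul_mem _ _ (F.first_mem p hp))
      (sum_mem fun a _ ↦ Submodule.smul_mem _ _ (F.mid_mem p hp a))
  have hne : F.coframe (Fin.last (m + 1)) p ≠ 0 := by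
    intro h0
    have := F.coframe_self hp (Fin.last (m + 1)) (Fin.last (m + 1))
    simp [h0] at this
  have heq := Submodule.eq_of_le_of_finrank_eq hle (by
    have h1 := Module.Dual.finrank_ker_add_one_of_ne_zero (K := ℝ) hne
    rw [finrank_tangentHyperplane hι]
    rw [finrank_tangentSpace] at h1
    omega)
  rw [← heq, LinearMap.mem_ker]

lemma val_first_of_mem (hι : Function.Injective (mfderiv (𝓡 (m + 1)) (𝓡 (m + 2)) ι p))
    (hp : p ∈ W) {v : TangentSpace (𝓡 (m + 2)) (ι p)} (hv : v ∈ tangentHyperplane ι p) :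
    g.val (ι p) v (F.e 0 (ι p)) = 0 := by
  rw [F.val_first hp, (F.mem_tangentHyperplane_iff hι hp).1 hv, neg_zero]

end Algebra

section Calculus

variable {D : CovariantDerivative (𝓡 (m + 2)) (EuclideanSpace ℝ (Fin (m + 2)))
      (TangentSpace (𝓡 (m + 2)) : M → Type _)}

include F in
lemma mvfderiv_eq_zero (hp : p ∈ W) (hι : MDifferentiableAt (𝓡 (m + 1)) (𝓡 (m + 2)) ι p)
    {f : M → ℝ} (hf : FunSmoothNear m f (ι p)) (h : ∀ q ∈ W, f (ι q) = 0)
    {v : TangentSpace (𝓡 (m + 2)) (ι p)} (hv : v ∈ tangentHyperplane ι p) :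
    mvfderiv (𝓡 (m + 2)) f (ι p) v = 0 :=
  mvfderiv_eq_zero_of_mem_tangentHyperplane hι hf.mdifferentiableAt
    (by filter_upwards [F.isOpen_dom.mem_nhds hp] with q hq using h q hq) hv

/-- Differentiate (e_1, e_1) = 0. The frame relations hold only along the hypersurface, hence the
restriction to tangent directions here and below. -/
lemma val_cov_first_first (hD : IsLeviCivita g D)
    (hι : MDifferentiableAt (𝓡 (m + 1)) (𝓡 (m + 2)) ι p) (hp : p ∈ W)
    {v : TangentSpace (𝓡 (m + 2)) (ι p)} (hv : v ∈ tangentHyperplane ι p) :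
    g.val (ι p) (D (F.e 0) (ι p) v) (F.e 0 (ι p)) = 0 := by
  have h0 := F.fieldSmoothNear hp 0
  have h := F.mvfderiv_eq_zero hp hι (h0.metric (g := g) h0) F.first_first hv
  rw [hD.mvfderiv_metric h0 h0, g.symm _ (F.e 0 (ι p))] at h
  linarith

lemma val_mid_cov_first (hD : IsLeviCivita g D)
    (hι : MDifferentiableAt (𝓡 (m + 1)) (𝓡 (m + 2)) ι p) (hp : p ∈ W)
    {v : TangentSpace (𝓡 (m + 2)) (ι p)} (hv : v ∈ tangentHyperplane ι p) (a : Fin m) :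
    g.val (ι p) (D (F.e 0) (ι p) v) (F.e (midIdx a) (ι p)) =
      - g.val (ι p) (D (F.e (midIdx a)) (ι p) v) (F.e 0 (ι p)) := by
  have h0 := F.fieldSmoothNear hp 0
  have ha := F.fieldSmoothNear hp (midIdx a)
  have h := F.mvfderiv_eq_zero hp hι (h0.metric (g := g) ha) (fun q hq ↦ F.first_mid q hq a) hv
  rw [hD.mvfderiv_metric h0 ha, g.symm _ (F.e 0 (ι p))] at h
  linarith

lemma secondFundamental_eq (hp : p ∈ W) (a b : Fin m) :
    F.secondFundamental D p a b =
      - g.val (ι p) (D (F.e (midIdx a)) (ι p) (F.e (midIdx b) (ι p))) (F.e 0 (ι p)) := by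
  simp [F.val_first hp, secondFundamental]

variable [IsManifold (𝓡 (m + 1)) ∞ V]

omit [IsManifold (𝓡 (m + 2)) ∞ M] [IsManifold (𝓡 (m + 1)) ∞ V] in
lemma _root_.Manifold.IsImmersion.mdifferentiableAt
    (hι : Manifold.IsImmersion (𝓡 (m + 1)) (𝓡 (m + 2)) ∞ ι) (p : V) :
    MDifferentiableAt (𝓡 (m + 1)) (𝓡 (m + 2)) ι p :=
  (hι.contMDiff p).mdifferentiableAt (by simp)

lemma _root_.Manifold.IsImmersion.mfderiv_injective
    (hι : Manifold.IsImmersion (𝓡 (m + 1)) (𝓡 (m + 2)) ∞ ι) (p : V) :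
    Function.Injective (mfderiv (𝓡 (m + 1)) (𝓡 (m + 2)) ι p) := by
  obtain ⟨f, -, h⟩ := hι.exists_definingFunction p
  exact h.self_of_nhds.2.2.1

include F in
lemma mlieBracket_mem (hι : Manifold.IsImmersion (𝓡 (m + 1)) (𝓡 (m + 2)) ∞ ι)
    (hp : p ∈ W) {i j : Fin (m + 2)} (hi : ∀ q ∈ W, F.e i (ι q) ∈ tangentHyperplane ι q)
    (hj : ∀ q ∈ W, F.e j (ι q) ∈ tangentHyperplane ι q) :
    mlieBracket (𝓡 (m + 2)) (F.e i) (F.e j) (ι p) ∈ tangentHyperplane ι p := by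
  refine hι.mlieBracket_mem_tangentHyperplane (F.fieldSmoothNear hp i) (F.fieldSmoothNear hp j)
    ?_ ?_
  · filter_upwards [F.isOpen_dom.mem_nhds hp] with q hq using hi q hq
  · filter_upwards [F.isOpen_dom.mem_nhds hp] with q hq using hj q hq

/-- The second fundamental tensor is symmetric. -/
lemma secondFundamental_symm (hD : IsLeviCivita g D)
    (hι : Manifold.IsImmersion (𝓡 (m + 1)) (𝓡 (m + 2)) ∞ ι) (hp : p ∈ W) (a b : Fin m) :
    F.secondFundamental D p a b = F.secondFundamental D p b a := by
  have h := F.val_first_of_mem (hι.mfderiv_injective p) hp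
    (F.mlieBracket_mem hι hp (fun q hq ↦ F.mid_mem q hq a) (fun q hq ↦ F.mid_mem q hq b))
  rw [hD.mlieBracket_eq (F.fieldSmoothNear hp _) (F.fieldSmoothNear hp _), map_sub,
    sub_apply] at h
  rw [F.secondFundamental_eq hp, F.secondFundamental_eq hp]
  linarith

/-- The forms `ω_a^n` vanish on the isotropic direction. -/
lemma val_cov_mid_first_first (hD : IsLeviCivita g D)
    (hι : Manifold.IsImmersion (𝓡 (m + 1)) (𝓡 (m + 2)) ∞ ι) (hp : p ∈ W) (a : Fin m) :
    g.val (ι p) (D (F.e (midIdx a)) (ι p) (F.e 0 (ι p))) (F.e 0 (ι p)) = 0 := by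
  -- The tangent vector [e_1, e_a] = ∇_{e_1} e_a - ∇_{e_a} e_1 is orthogonal to e_1, and so is
  -- ∇_{e_a} e_1.
  have h := F.val_first_of_mem (hι.mfderiv_injective p) hp
    (F.mlieBracket_mem hι hp F.first_mem (fun q hq ↦ F.mid_mem q hq a))
  rw [hD.mlieBracket_eq (F.fieldSmoothNear hp _) (F.fieldSmoothNear hp _), map_sub,
    sub_apply, F.val_cov_first_first hD (hι.mdifferentiableAt p) hp (F.mid_mem p hp a),
    sub_zero] at h
  exact h

/-- The expansion `ω_a^n = λ_ab ω^b` on the tangent hyperplane. -/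
lemma val_cov_mid_first (hD : IsLeviCivita g D)
    (hι : Manifold.IsImmersion (𝓡 (m + 1)) (𝓡 (m + 2)) ∞ ι) (hp : p ∈ W) (a : Fin m)
    {v : TangentSpace (𝓡 (m + 2)) (ι p)} (hv : v ∈ tangentHyperplane ι p) :
    g.val (ι p) (D (F.e (midIdx a)) (ι p) v) (F.e 0 (ι p)) =
      - ∑ c, F.secondFundamental D p a c * F.coframe (midIdx c) p v := by
  conv_lhs => rw [← F.sum_coframe hp v, sum_univ_eq_first_mid_last,
    (F.mem_tangentHyperplane_iff (hι.mfderiv_injective p) hp).1 hv]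
  simp only [zero_smul, add_zero, map_add, map_smul, map_sum, add_apply, smul_apply, sum_apply,
    F.val_cov_mid_first_first hD hι hp, mul_zero, zero_add, F.secondFundamental_eq hp,
    smul_eq_mul, ← Finset.sum_neg_distrib]
  exact Finset.sum_congr rfl fun c _ ↦ by ring

/-- `∇_{e_1} e_1` is proportional to `e_1`. -/
lemma cov_first_first (hD : IsLeviCivita g D)
    (hι : Manifold.IsImmersion (𝓡 (m + 1)) (𝓡 (m + 2)) ∞ ι) (hp : p ∈ W) :
    D (F.e 0) (ι p) (F.e 0 (ι p)) =
      F.coframe 0 p (D (F.e 0) (ι p) (F.e 0 (ι p))) • F.e 0 (ι p) := by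
  refine F.eq_of_val_eq hp fun i ↦ ?_
  rw [map_smul, smul_apply, smul_eq_mul]
  obtain rfl | ⟨a, rfl⟩ | rfl := eq_first_or_mid_or_last i
  · rw [F.val_cov_first_first hD (hι.mdifferentiableAt p) hp (F.first_mem p hp),
      F.first_first p hp, mul_zero]
  · rw [F.val_mid_cov_first hD (hι.mdifferentiableAt p) hp (F.first_mem p hp),
      F.val_cov_mid_first_first hD hι hp, F.first_mid p hp, mul_zero, neg_zero]
  · rw [F.val_last hp, F.first_last p hp, mul_neg_one]

end Calculus

end IsotropicFrame

end

/-! ### Derivative of the second fundamental tensor along e_1 -/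

section

namespace IsotropicFrame

variable {m : ℕ} {M : Type*} [TopologicalSpace M] [T2Space M]
  [ChartedSpace (EuclideanSpace ℝ (Fin (m + 2))) M] [IsManifold (𝓡 (m + 2)) ∞ M]
  {V : Type*} [TopologicalSpace V]
  [ChartedSpace (EuclideanSpace ℝ (Fin (m + 1))) V]
  {g : LorentzMetric m M} {ι : V → M} {W : Set V} (F : IsotropicFrame g ι W) {p : V}
  {D : CovariantDerivative (𝓡 (m + 2)) (EuclideanSpace ℝ (Fin (m + 2)))
      (TangentSpace (𝓡 (m + 2)) : M → Type _)}

-- The 2 undoes the halving in `curvatureComponent`; the sign of `val_first` is absorbed by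
-- exchanging e_1 and e_b.
omit [T2Space M] in
lemma curvatureTerm_eq (hp : p ∈ W) (a b : Fin m) :
    2 * F.curvatureTerm D p a b = g.val (ι p) (curvature D (ι p) (F.e 0 (ι p))
      (F.e (midIdx b) (ι p)) (F.e (midIdx a) (ι p))) (F.e 0 (ι p)) := by
  rw [curvature_swap, map_neg, neg_apply, F.val_first hp]
  simp [curvatureTerm, curvatureComponent]
  ring

variable [IsManifold (𝓡 (m + 1)) ∞ V]

/-- The derivative of the second fundamental tensor along the isotropic direction field, in terms
of the scalar product. -/
lemma mvfderiv_secondFundamental (hD : IsLeviCivita g D)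
    (hι : Manifold.IsImmersion (𝓡 (m + 1)) (𝓡 (m + 2)) ∞ ι) (hp : p ∈ W) (a b : Fin m)
    {X : TangentSpace (𝓡 (m + 1)) p}
    (hX : mfderiv (𝓡 (m + 1)) (𝓡 (m + 2)) ι p X = F.e 0 (ι p)) :
    mvfderiv (𝓡 (m + 1)) (fun q : V ↦ F.secondFundamental D q a b) p X =
      - (2 * F.curvatureTerm D p a b)
      + g.val (ι p) (D (F.e (midIdx a)) (ι p) (F.e 0 (ι p)))
          (D (F.e 0) (ι p) (F.e (midIdx b) (ι p)))
      - g.val (ι p) (D (F.e (midIdx a)) (ι p)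
          (mlieBracket (𝓡 (m + 2)) (F.e 0) (F.e (midIdx b)) (ι p))) (F.e 0 (ι p))
      - g.val (ι p) (D (F.e (midIdx a)) (ι p) (F.e (midIdx b) (ι p)))
          (D (F.e 0) (ι p) (F.e 0 (ι p))) := by
  have h0 := F.fieldSmoothNear hp 0
  have ha := F.fieldSmoothNear hp (midIdx a)
  have hb := F.fieldSmoothNear hp (midIdx b)
  have hba := ha.cov hD.smooth hb
  have h0a := ha.cov hD.smooth h0
  have hιp := hι.mdifferentiableAt p
  -- Near p the function λ_ab on the hypersurface is the pullback of a smooth function on the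
  -- ambient manifold, so the chain rule reduces its derivative to one along e_1.
  have h1 : (fun q : V ↦ F.secondFundamental D q a b) =ᶠ[𝓝 p]
      (fun y ↦ - g.val y (D (F.e (midIdx a)) y (F.e (midIdx b) y)) (F.e 0 y)) ∘ ι := by
    filter_upwards [F.isOpen_dom.mem_nhds hp] with q hq
    exact F.secondFundamental_eq hq a b
  have h2 : mvfderiv (𝓡 (m + 1)) (fun q : V ↦ F.secondFundamental D q a b) p X =
      - mvfderiv (𝓡 (m + 2))
        (fun y ↦ g.val y (D (F.e (midIdx a)) y (F.e (midIdx b) y)) (F.e 0 y)) (ι p)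
          (F.e 0 (ι p)) := by
    have h3 := congrArg (fun T : TangentSpace (𝓡 (m + 1)) p →L[ℝ] ℝ ↦ T X)
      (h1.mfderiv_eq (I := 𝓡 (m + 1)) (I' := 𝓘(ℝ, ℝ)))
    refine h3.trans ?_
    refine (mvfderiv_comp_apply (f := ι)
      (g := fun y ↦ - g.val y (D (F.e (midIdx a)) y (F.e (midIdx b) y)) (F.e 0 y)) p
      (hba.metric h0).neg.mdifferentiableAt hιp X).trans ?_
    rw [hX]
    exact congrArg (fun T : TangentSpace (𝓡 (m + 2)) (ι p) →L[ℝ] ℝ ↦ T (F.e 0 (ι p)))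
      (mvfderiv_neg (I := 𝓡 (m + 2)) (x := ι p)
        (g := fun y ↦ g.val y (D (F.e (midIdx a)) y (F.e (midIdx b) y)) (F.e 0 y)))
  -- Differentiating (∇_{e_1} e_a, e_1) = 0 along e_b supplies the second half of the curvature
  -- commutator.
  have h4 := F.mvfderiv_eq_zero hp hιp (h0a.metric (g := g) h0)
    (fun q hq ↦ F.val_cov_mid_first_first hD hι hq a) (F.mid_mem p hp b)
  rw [hD.mvfderiv_metric h0a h0] at h4
  rw [h2, hD.mvfderiv_metric hba h0, F.curvatureTerm_eq hp, ← hD.curvatureField_eq h0 hb ha]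
  simp only [curvatureField, map_sub, sub_apply]
  linear_combination -h4

/-- The derivative of the second fundamental tensor along the isotropic direction field. -/
theorem covDerivSecondFundamental_eq (hD : IsLeviCivita g D)
    (hι : Manifold.IsImmersion (𝓡 (m + 1)) (𝓡 (m + 2)) ∞ ι) (hp : p ∈ W)
    {X : TangentSpace (𝓡 (m + 1)) p}
    (hX : mfderiv (𝓡 (m + 1)) (𝓡 (m + 2)) ι p X = F.e 0 (ι p)) :
    F.covDerivSecondFundamental D p X =
      secondOrderExpression (F.firstFundamental p) (F.secondFundamental D p)
        - (2 : ℝ) • F.curvatureTerm D p := by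
  have hιp := hι.mdifferentiableAt p
  have hinj := hι.mfderiv_injective p
  set L := F.secondFundamental D p
  set G := F.firstFundamental p
  -- The components of ∇_{e_b} e_1 along e_c. Differentiating (e_1, e_d) = 0 along e_b gives G ν =
  -- L, so ν is λ with an index raised.
  let ν : Matrix (Fin m) (Fin m) ℝ := Matrix.of fun c b ↦
    F.coframe (midIdx c) p (D (F.e 0) (ι p) (F.e (midIdx b) (ι p)))
  have hν : G⁻¹ * L = ν := by
    have hG : IsUnit G.det := (Matrix.isUnit_iff_isUnit_det _).1 (F.posDef p hp).isUnit
    have h1 : G * ν = L := by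
      ext d b
      have h2 := F.val_mid_cov_first hD hιp hp (F.mid_mem p hp b) d
      rw [F.val_mid hp, ← F.secondFundamental_eq hp] at h2
      rw [Matrix.mul_apply]
      refine Eq.trans (Finset.sum_congr rfl fun c _ ↦ ?_) h2
      exact (mul_comm _ _).trans (congrArg _ (F.firstFundamental_symm p d c))
    rw [← h1, Matrix.nonsing_inv_mul_cancel_left _ _ hG]
  ext a b
  have hbr : mlieBracket (𝓡 (m + 2)) (F.e 0) (F.e (midIdx b)) (ι p) ∈ tangentHyperplane ι p :=
    F.mlieBracket_mem hι hp F.first_mem (fun q hq ↦ F.mid_mem q hq b)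
  -- The bracket yields the quadratic term and the ω_b^c term; `t2` and `t3` yield the ω_a^c and
  -- ω_1^1 terms.
  have t1 : g.val (ι p) (D (F.e (midIdx a)) (ι p)
      (mlieBracket (𝓡 (m + 2)) (F.e 0) (F.e (midIdx b)) (ι p))) (F.e 0 (ι p)) =
      (∑ c, L a c * ν c b) - ∑ c, L a c * F.connectionForm D (midIdx b) (midIdx c) p X := by
    rw [F.val_cov_mid_first hD hι hp a hbr, hD.mlieBracket_eq (F.fieldSmoothNear hp _)
      (F.fieldSmoothNear hp _), ← Finset.sum_sub_distrib, ← Finset.sum_neg_distrib]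
    refine Finset.sum_congr rfl fun c _ ↦ ?_
    simp only [connectionForm, hX, map_sub, ν, Matrix.of_apply]
    ring
  have t2 : g.val (ι p) (D (F.e (midIdx a)) (ι p) (F.e 0 (ι p)))
      (D (F.e 0) (ι p) (F.e (midIdx b) (ι p))) =
      ∑ c, L c b * F.connectionForm D (midIdx a) (midIdx c) p X := by
    have h1 := F.val_cov_mid_first_first hD hι hp a
    rw [F.val_first hp, neg_eq_zero] at h1
    rw [F.val_eq hp, h1, g.symm _ (F.e 0 (ι p)),
      F.val_cov_first_first hD hιp hp (F.mid_mem p hp b), mul_zero, zero_mul, zero_add, add_zero]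
    refine Finset.sum_congr rfl fun c _ ↦ ?_
    rw [g.symm, F.val_mid_cov_first hD hιp hp (F.mid_mem p hp b), ← F.secondFundamental_eq hp,
      connectionForm, hX, mul_comm]
  have t3 : g.val (ι p) (D (F.e (midIdx a)) (ι p) (F.e (midIdx b) (ι p)))
      (D (F.e 0) (ι p) (F.e 0 (ι p))) = - (L a b * F.connectionForm D 0 0 p X) := by
    rw [F.cov_first_first hD hι hp, map_smul, smul_eq_mul, connectionForm, hX]
    have := F.secondFundamental_eq (D := D) hp a b
    linear_combination (F.coframe 0 p (D (F.e 0) (ι p) (F.e 0 (ι p)))) * this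
  have t4 : secondOrderExpression G L a b = - ∑ c, L a c * ν c b := by
    rw [secondOrderExpression, Matrix.mul_assoc, hν, Matrix.neg_apply, Matrix.mul_apply]
  rw [Matrix.sub_apply, Matrix.smul_apply, t4, smul_eq_mul, covDerivSecondFundamental,
    Matrix.of_apply, F.mvfderiv_secondFundamental hD hι hp a b hX, t1, t2, t3]
  ring

omit [T2Space M] in
lemma covDerivSecondFundamental_symm (hD : IsLeviCivita g D)
    (hι : Manifold.IsImmersion (𝓡 (m + 1)) (𝓡 (m + 2)) ∞ ι) (hp : p ∈ W)
    (X : TangentSpace (𝓡 (m + 1)) p) (a b : Fin m) :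
    F.covDerivSecondFundamental D p X a b = F.covDerivSecondFundamental D p X b a := by
  have h1 : (fun q : V ↦ F.secondFundamental D q a b) =ᶠ[𝓝 p]
      (fun q : V ↦ F.secondFundamental D q b a) := by
    filter_upwards [F.isOpen_dom.mem_nhds hp] with q hq
    exact F.secondFundamental_symm hD hι hq a b
  have h2 : mvfderiv (𝓡 (m + 1)) (fun q : V ↦ F.secondFundamental D q a b) p X =
      mvfderiv (𝓡 (m + 1)) (fun q : V ↦ F.secondFundamental D q b a) p X :=
    congrArg (fun T : TangentSpace (𝓡 (m + 1)) p →L[ℝ] ℝ ↦ T X)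
      (h1.mfderiv_eq (I := 𝓡 (m + 1)) (I' := 𝓘(ℝ, ℝ)))
  simp only [covDerivSecondFundamental, Matrix.of_apply, h2,
    F.secondFundamental_symm hD hι hp _ b, F.secondFundamental_symm hD hι hp a]
  ring

/-- Read off the derivative formula, whose other terms are symmetric because λ and g are; no Bianchi
identity is used. It is what makes polarization work later. -/
lemma curvatureTerm_symm (hD : IsLeviCivita g D)
    (hι : Manifold.IsImmersion (𝓡 (m + 1)) (𝓡 (m + 2)) ∞ ι) (hp : p ∈ W) (a b : Fin m) :
    F.curvatureTerm D p a b = F.curvatureTerm D p b a := by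
  obtain ⟨X, hX⟩ := F.first_mem p hp
  have h := F.covDerivSecondFundamental_symm hD hι hp X a b
  have hL : (F.secondFundamental D p).transpose = F.secondFundamental D p := by
    ext a b; exact F.secondFundamental_symm hD hι hp b a
  have hG : (F.firstFundamental p).transpose = F.firstFundamental p := by
    ext a b; exact F.firstFundamental_symm p b a
  have hS : (secondOrderExpression (F.firstFundamental p) (F.secondFundamental D p)).transpose =
      secondOrderExpression (F.firstFundamental p) (F.secondFundamental D p) := by
    simp [secondOrderExpression, Matrix.transpose_mul, Matrix.transpose_nonsing_inv, hL, hG,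
      Matrix.mul_assoc]
  have hS' := congrFun (congrFun hS b) a
  rw [Matrix.transpose_apply] at hS'
  rw [F.covDerivSecondFundamental_eq hD hι hp hX, Matrix.sub_apply, Matrix.sub_apply,
    Matrix.smul_apply, Matrix.smul_apply, smul_eq_mul, smul_eq_mul, hS'] at h
  linarith

end IsotropicFrame

end

/-! ### Isotropic sectional curvature as a quadratic form -/

section

namespace IsotropicFrame

variable {m : ℕ} {M : Type*} [TopologicalSpace M]
  [ChartedSpace (EuclideanSpace ℝ (Fin (m + 2))) M] [IsManifold (𝓡 (m + 2)) ∞ M]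
  {V : Type*} [TopologicalSpace V]
  [ChartedSpace (EuclideanSpace ℝ (Fin (m + 1))) V]
  {g : LorentzMetric m M} {ι : V → M} {W : Set V} (F : IsotropicFrame g ι W) {p : V}
  {D : CovariantDerivative (𝓡 (m + 2)) (EuclideanSpace ℝ (Fin (m + 2)))
      (TangentSpace (𝓡 (m + 2)) : M → Type _)}

/-- The vector `x^a e_a`. -/
def midVector (p : V) (c : Fin m → ℝ) : TangentSpace (𝓡 (m + 2)) (ι p) :=
  ∑ a, c a • F.e (midIdx a) (ι p)

lemma midVector_mem (hp : p ∈ W) (c : Fin m → ℝ) : F.midVector p c ∈ tangentHyperplane ι p :=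
  sum_mem fun a _ ↦ Submodule.smul_mem _ _ (F.mid_mem p hp a)

lemma val_first_midVector (hp : p ∈ W) (c : Fin m → ℝ) :
    g.val (ι p) (F.e 0 (ι p)) (F.midVector p c) = 0 := by
  simp [midVector, F.first_mid p hp]

lemma val_midVector_pos (hp : p ∈ W) {c : Fin m → ℝ} (hc : c ≠ 0) :
    0 < g.val (ι p) (F.midVector p c) (F.midVector p c) := by
  have h := (F.posDef p hp).dotProduct_mulVec_pos hc
  refine lt_of_lt_of_eq h ?_
  simp only [midVector, dotProduct, Matrix.mulVec, Finset.mul_sum, map_sum, map_smul, sum_apply,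
    smul_apply, smul_eq_mul, star_trivial, Matrix.of_apply]
  refine Finset.sum_congr rfl fun a _ ↦ Finset.sum_congr rfl fun b _ ↦ ?_
  rw [g.symm]
  ring

lemma eq_smul_first_add_midVector
    (hι : Function.Injective (mfderiv (𝓡 (m + 1)) (𝓡 (m + 2)) ι p)) (hp : p ∈ W)
    {v : TangentSpace (𝓡 (m + 2)) (ι p)} (hv : v ∈ tangentHyperplane ι p) :
    ∃ (s : ℝ) (c : Fin m → ℝ), v = s • F.e 0 (ι p) + F.midVector p c := by
  refine ⟨F.coframe 0 p v, fun a ↦ F.coframe (midIdx a) p v, ?_⟩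
  conv_lhs => rw [← F.sum_coframe hp v, sum_univ_eq_first_mid_last,
    (F.mem_tangentHyperplane_iff hι hp).1 hv]
  simp [midVector]

variable [T2Space M]

lemma val_curvature_mid (hD : IsLeviCivita g D) (hp : p ∈ W) (a b : Fin m) :
    g.val (ι p) (curvature D (ι p) (F.e (midIdx b) (ι p)) (F.e 0 (ι p)) (F.e 0 (ι p)))
      (F.e (midIdx a) (ι p)) = 2 * F.curvatureTerm D p a b := by
  rw [hD.val_curvature_antisymm, F.curvatureTerm_eq hp, curvature_swap, map_neg, neg_apply,
    neg_neg]

/-- Links the numerator of the sectional curvature to the quadratic form of R^n_{ab1}. -/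
lemma val_curvature_midVector (hD : IsLeviCivita g D) (hp : p ∈ W) (c : Fin m → ℝ) :
    g.val (ι p) (curvature D (ι p) (F.midVector p c) (F.e 0 (ι p)) (F.e 0 (ι p)))
      (F.midVector p c) = 2 * ∑ a, ∑ b, c a * c b * F.curvatureTerm D p a b := by
  let A : TangentSpace (𝓡 (m + 2)) (ι p) →ₗ[ℝ] TangentSpace (𝓡 (m + 2)) (ι p) :=
    { toFun v := curvature D (ι p) v (F.e 0 (ι p)) (F.e 0 (ι p))
      map_add' u v := hD.curvature_add_left u v _ _
      map_smul' s u := hD.curvature_smul_left s u _ _ }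
  have hA : curvature D (ι p) (F.midVector p c) (F.e 0 (ι p)) (F.e 0 (ι p)) =
      ∑ b, c b • curvature D (ι p) (F.e (midIdx b) (ι p)) (F.e 0 (ι p)) (F.e 0 (ι p)) := by
    change A (F.midVector p c) = ∑ b, c b • A (F.e (midIdx b) (ι p))
    simp [midVector]
  rw [hA, midVector, Finset.mul_sum, map_sum]
  refine Finset.sum_congr rfl fun a _ ↦ ?_
  simp only [map_sum, map_smul, sum_apply, smul_apply, F.val_curvature_mid hD hp, smul_eq_mul,
    Finset.mul_sum]
  exact Finset.sum_congr rfl fun b _ ↦ by ring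

/-- Null isotropic sectional curvature makes the components `R^n_{ab1}` vanish. -/
lemma curvatureTerm_eq_zero [IsManifold (𝓡 (m + 1)) ∞ V] (hD : IsLeviCivita g D)
    (hι : Manifold.IsImmersion (𝓡 (m + 1)) (𝓡 (m + 2)) ∞ ι)
    (h : HasNullIsotropicSectionalCurvature g D ι) (hp : p ∈ W) : F.curvatureTerm D p = 0 := by
  -- Test the hypothesis on the isotropic plane spanned by e_1 and P = x^a e_a; (P, P) > 0, so the
  -- numerator must vanish.
  have quad (c : Fin m → ℝ) : ∑ a, ∑ b, c a * c b * F.curvatureTerm D p a b = 0 := by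
    by_cases hc : c = 0
    · simp [hc]
    set N := F.e 0 (ι p)
    set P := F.midVector p c
    have hPP : g.val (ι p) P P ≠ 0 := (F.val_midVector_pos hp hc).ne'
    have hNP : g.val (ι p) N P = 0 := F.val_first_midVector hp c
    have hNN : g.val (ι p) N N = 0 := F.first_first p hp
    have hN0 : N ≠ 0 := fun h0 ↦ by
      have := F.first_last p hp
      rw [show F.e 0 (ι p) = 0 from h0] at this
      simp at this
    have hli : LinearIndependent ℝ ![N, P] := by
      refine LinearIndependent.pair_iff.2 fun s t hst ↦ ?_
      have ht : t = 0 := by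
        have := congrArg (fun v ↦ g.val (ι p) v P) hst
        simpa [hNP, hPP] using this
      simp only [ht, zero_smul, add_zero, smul_eq_zero, hN0, or_false] at hst
      exact ⟨hst, ht⟩
    have hN : N ∈ Submodule.span ℝ (Set.range ![N, P]) := Submodule.subset_span ⟨0, rfl⟩
    have hP : P ∈ Submodule.span ℝ (Set.range ![N, P]) := Submodule.subset_span ⟨1, rfl⟩
    have key := h p (Submodule.span ℝ (Set.range ![N, P])) ?_ ⟨?_, N, hN, hN0, ?_⟩ N hN hN0 hNN
      P hP hPP
    · have h2 := F.val_curvature_midVector hD hp c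
      rw [isotropicSectionalCurvature, div_eq_zero_iff, or_iff_left hPP] at key
      linarith
    · rw [Submodule.span_le]
      rintro _ ⟨i, rfl⟩
      fin_cases i
      · exact F.first_mem p hp
      · exact F.midVector_mem hp c
    · simpa using finrank_span_eq_card hli
    · intro w hw
      induction hw using Submodule.span_induction with
      | mem w hw =>
        obtain ⟨i, rfl⟩ := hw
        fin_cases i
        · exact hNN
        · exact hNP
      | zero => simp
      | add u v _ _ hu hv => simp [hu, hv]
      | smul s u _ hu => simp [hu]
  have diag (a : Fin m) : F.curvatureTerm D p a a = 0 := by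
    simpa [Pi.single_apply] using quad (Pi.single a 1)
  ext a b
  -- Polarization: with zero diagonal and symmetry, the value at the sum of two unit vectors is
  -- twice the (a, b) entry.
  have h2 := quad (Pi.single a 1 + Pi.single b 1)
  simp only [Pi.add_apply, add_mul, mul_add, Finset.sum_add_distrib] at h2
  simp [Pi.single_apply, diag, F.curvatureTerm_symm hD hι hp b a] at h2
  simpa using h2

/-- The isotropic sectional curvature vanishes where the components `R^n_{ab1}` do. -/
lemma isotropicSectionalCurvature_eq_zero (hD : IsLeviCivita g D)
    (hι : Function.Injective (mfderiv (𝓡 (m + 1)) (𝓡 (m + 2)) ι p)) (hp : p ∈ W)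
    (h : F.curvatureTerm D p = 0) {N P : TangentSpace (𝓡 (m + 2)) (ι p)}
    (hN : N ∈ tangentHyperplane ι p) (hNN : g.val (ι p) N N = 0)
    (hP : P ∈ tangentHyperplane ι p) : isotropicSectionalCurvature g D (ι p) N P = 0 := by
  obtain ⟨s, c, rfl⟩ := F.eq_smul_first_add_midVector hι hp hN
  obtain ⟨t, d, rfl⟩ := F.eq_smul_first_add_midVector hι hp hP
  -- (N, N) is the positive definite form of the e_a-part alone, so an isotropic N is a multiple of
  -- e_1.
  have hc : c = 0 := by
    by_contra hc
    have h1 := F.val_midVector_pos hp hc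
    simp only [map_add, map_smul, add_apply, smul_apply, F.first_first p hp,
      F.val_first_midVector hp, g.symm (ι p) (F.midVector p c) (F.e 0 (ι p)), smul_eq_mul,
      mul_zero, zero_add] at hNN
    exact h1.ne' hNN
  have hc' : F.midVector p c = 0 := by simp [hc, midVector]
  rw [hc', add_zero, isotropicSectionalCurvature]
  set N := F.e 0 (ι p)
  set Q := F.midVector p d
  have hself : curvature D (ι p) N N N = 0 := by
    have h := curvature_swap (D := D) N N N
    rwa [eq_neg_iff_add_eq_zero, ← two_smul ℝ, smul_eq_zero_iff_right two_ne_zero] at h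
  have h3 (u : TangentSpace (𝓡 (m + 2)) (ι p)) : g.val (ι p) (curvature D (ι p) u N N) N = 0 :=
    self_eq_neg.1 (hD.val_curvature_antisymm u N N N)
  have hQ : g.val (ι p) (curvature D (ι p) Q N N) Q = 0 := by
    rw [F.val_curvature_midVector hD hp, h]
    simp
  -- Linearity of the curvature is at hand in its first slot only; the skew-symmetries bring the
  -- scalar and the sum into that slot or into the metric.
  rw [hD.val_curvature_antisymm, map_smul, curvature_swap, hD.curvature_smul_left, map_neg,
    map_smul, neg_apply, smul_apply, curvature_swap, map_neg, neg_apply,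
    hD.val_curvature_antisymm, hD.curvature_add_left, hD.curvature_smul_left, hself]
  simp [h3, hQ]

end IsotropicFrame

end

/-! ### Gradients and Lorentzian linear algebra -/

section

section Smooth

variable {m : ℕ} {M : Type*} [TopologicalSpace M]
  [ChartedSpace (EuclideanSpace ℝ (Fin (m + 2))) M] {x : M}

lemma FunSmoothNear.det {n : Type*} [Fintype n] [DecidableEq n] {A : M → Matrix n n ℝ}
    (hA : ∀ i j, FunSmoothNear m (fun y ↦ A y i j) x) : FunSmoothNear m (fun y ↦ (A y).det) x := by
  simp only [Matrix.det_apply']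
  exact .sum fun σ _ ↦ (FunSmoothNear.const _).mul (.prod fun i _ ↦ hA _ _)

lemma FunSmoothNear.matrix_inv {n : Type*} [Fintype n] [DecidableEq n] {A : M → Matrix n n ℝ}
    (hA : ∀ i j, FunSmoothNear m (fun y ↦ A y i j) x) (h0 : (A x).det ≠ 0) (i j : n) :
    FunSmoothNear m (fun y ↦ (A y)⁻¹ i j) x := by
  have h1 : FunSmoothNear m (fun y ↦ (A y).adjugate i j) x := by
    simp only [Matrix.adjugate_apply]
    refine FunSmoothNear.det fun k l ↦ ?_
    obtain rfl | hk := eq_or_ne k j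
    · simpa using FunSmoothNear.const _
    · simpa [Matrix.updateRow_ne hk] using hA k l
  simpa [Matrix.inv_def] using ((FunSmoothNear.det hA).inv h0).mul h1

end Smooth

variable {m : ℕ} {M : Type*} [TopologicalSpace M]
  [ChartedSpace (EuclideanSpace ℝ (Fin (m + 2))) M] [IsManifold (𝓡 (m + 2)) ∞ M]
  {g : LorentzMetric m M} {x : M}

namespace LorentzMetric

/-- The Gram matrix of a family of tangent vectors. -/
def gram (g : LorentzMetric m M) (e : Fin (m + 2) → TangentSpace (𝓡 (m + 2)) x) :
    Matrix (Fin (m + 2)) (Fin (m + 2)) ℝ :=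
  Matrix.of fun i j ↦ g.val x (e i) (e j)

lemma gram_mulVec (e : Fin (m + 2) → TangentSpace (𝓡 (m + 2)) x) (c : Fin (m + 2) → ℝ)
    (i : Fin (m + 2)) : (g.gram e).mulVec c i = g.val x (e i) (∑ j, c j • e j) := by
  simp [gram, Matrix.mulVec, dotProduct, mul_comm]

lemma eq_zero_of_forall_val_basis {e : Fin (m + 2) → TangentSpace (𝓡 (m + 2)) x}
    (he : ⊤ ≤ Submodule.span ℝ (Set.range e)) {v : TangentSpace (𝓡 (m + 2)) x}
    (h : ∀ i, g.val x (e i) v = 0) : v = 0 := by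
  refine g.eq_of_forall_val_eq fun u ↦ ?_
  obtain ⟨c, rfl⟩ := (Submodule.mem_span_range_iff_exists_fun ℝ).1 (he (Submodule.mem_top (x := u)))
  simp [g.symm x v, h]

omit [IsManifold (𝓡 (m + 2)) ∞ M] in
lemma span_eq_top {e : Fin (m + 2) → TangentSpace (𝓡 (m + 2)) x}
    (he : LinearIndependent ℝ e) : Submodule.span ℝ (Set.range e) = ⊤ :=
  he.span_eq_top_of_card_eq_finrank' (by rw [finrank_tangentSpace]; simp)

/-- Turns independence into a nonvanishing smooth function, hence an open condition; it also makes
the Gram matrix invertible for gradients. -/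
lemma linearIndependent_iff_gram {e : Fin (m + 2) → TangentSpace (𝓡 (m + 2)) x} :
    LinearIndependent ℝ e ↔ (g.gram e).det ≠ 0 := by
  refine ⟨fun he h0 ↦ ?_, fun h ↦ Fintype.linearIndependent_iff.2 fun c hc ↦ ?_⟩
  · obtain ⟨c, hc, hGc⟩ := Matrix.exists_mulVec_eq_zero_iff.2 h0
    refine hc (funext (Fintype.linearIndependent_iff.1 he c ?_))
    exact eq_zero_of_forall_val_basis (g := g) (span_eq_top he).ge fun i ↦ by
      rw [← gram_mulVec, hGc, Pi.zero_apply]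
  · exact congrFun (Matrix.eq_zero_of_mulVec_eq_zero h (funext fun i ↦ by
      rw [gram_mulVec, hc, map_zero, Pi.zero_apply]))

/-- A smooth function has, locally, a smooth gradient. -/
lemma exists_gradient (g : LorentzMetric m M) {f : M → ℝ} (hf : FunSmoothNear m f x) :
    ∃ N : Π y : M, TangentSpace (𝓡 (m + 2)) y, FieldSmoothNear N x ∧
      ∀ᶠ y in 𝓝 x, ∀ v, g.val y (N y) v = mvfderiv (𝓡 (m + 2)) f y v := by
  let t := trivializationAt (EuclideanSpace ℝ (Fin (m + 2)))
    (TangentSpace (𝓡 (m + 2)) : M → Type _) x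
  let b := (EuclideanSpace.basisFun (Fin (m + 2)) ℝ).toBasis
  have ht : t.baseSet ∈ 𝓝 x :=
    t.open_baseSet.mem_nhds (FiberBundle.mem_baseSet_trivializationAt' x)
  let s : Fin (m + 2) → Π y : M, TangentSpace (𝓡 (m + 2)) y := t.localFrame b
  have hs (i) : FieldSmoothNear (s i) x := by
    filter_upwards [ht] with y hy using contMDiffAt_localFrame_of_mem _ t b i hy
  have hli : ∀ y ∈ t.baseSet, LinearIndependent ℝ fun i ↦ s i y :=
    fun y hy ↦ (t.isLocalFrameOn_localFrame_baseSet (𝓡 (m + 2)) ∞ b).linearIndependent hy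
  let G (y : M) := g.gram fun i ↦ s i y
  have hG (i j) : FunSmoothNear m (fun y ↦ G y i j) x := (hs i).metric (hs j)
  have hG0 : (G x).det ≠ 0 := linearIndependent_iff_gram.1 (hli x (mem_of_mem_nhds ht))
  -- The gradient g^{ij} s_j(f) s_i in a local frame s_i.
  refine ⟨fun y ↦ ∑ i, (∑ j, (G y)⁻¹ i j * mvfderiv (𝓡 (m + 2)) f y (s j y)) • s i y,
    .sum fun i _ ↦ .smul (.sum fun j _ ↦ (FunSmoothNear.matrix_inv hG hG0 i j).mul
      ((hs j).mvfderiv hf)) (hs i), ?_⟩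
  filter_upwards [ht] with y hy v
  have hdet : (G y).det ≠ 0 := linearIndependent_iff_gram.1 (hli y hy)
  have key (k) : g.val y (s k y) (∑ i, (∑ j, (G y)⁻¹ i j *
      mvfderiv (𝓡 (m + 2)) f y (s j y)) • s i y) = mvfderiv (𝓡 (m + 2)) f y (s k y) := by
    have h := g.gram_mulVec (fun i ↦ s i y)
      ((G y)⁻¹.mulVec fun j ↦ mvfderiv (𝓡 (m + 2)) f y (s j y)) k
    rw [Matrix.mulVec_mulVec, Matrix.mul_nonsing_inv _ hdet.isUnit, Matrix.one_mulVec] at h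
    exact h.symm
  suffices H : ∀ u, (∀ k, g.val y (s k y) u = mvfderiv (𝓡 (m + 2)) f y (s k y)) →
      g.val y u v = mvfderiv (𝓡 (m + 2)) f y v from H _ key
  intro u hu
  obtain ⟨c, rfl⟩ := (Submodule.mem_span_range_iff_exists_fun ℝ).1
    ((span_eq_top (hli y hy)).ge (Submodule.mem_top (x := v)))
  simp [g.symm y u, hu]

/-- A vector orthogonal to a nonzero isotropic vector `N` is spacelike or proportional to `N`. -/
lemma val_self_pos_or_eq_smul {N P : TangentSpace (𝓡 (m + 2)) x} (hN : N ≠ 0)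
    (hNN : g.val x N N = 0) (hNP : g.val x N P = 0) : 0 < g.val x P P ∨ ∃ c : ℝ, P = c • N := by
  obtain ⟨b, hb⟩ := g.signature x
  have hval (v w) : g.val x v w =
      - (b.repr v 0 * b.repr w 0) + ∑ i : Fin (m + 1), b.repr v i.succ * b.repr w i.succ := by
    conv_lhs => rw [← b.sum_repr v, ← b.sum_repr w]
    simp only [map_sum, map_smul, sum_apply, smul_apply, hb, smul_eq_mul, mul_ite, mul_one,
      mul_neg, mul_zero, Finset.sum_ite_eq', Finset.mem_univ, if_true]
    rw [Fin.sum_univ_succ]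
    simp [Fin.succ_ne_zero, mul_comm]
  have hzero {v} (h0 : b.repr v 0 = 0) (hv : g.val x v v ≤ 0) : v = 0 := by
    rw [hval, h0, mul_zero, neg_zero, zero_add] at hv
    have h1 := (Finset.sum_eq_zero_iff_of_nonneg fun i _ ↦ mul_self_nonneg _).1
      (le_antisymm hv (Finset.sum_nonneg fun i _ ↦ mul_self_nonneg _))
    refine b.repr.map_eq_zero_iff.1 (Finsupp.ext fun i ↦ ?_)
    induction i using Fin.cases with
    | zero => exact h0
    | succ i => exact mul_self_eq_zero.1 (h1 i (Finset.mem_univ i))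
  have hN0 : b.repr N 0 ≠ 0 := fun h0 ↦ hN (hzero h0 hNN.le)
  -- The multiple of N is chosen so that P - cN has no timelike coordinate. Its square equals (P, P)
  -- ≤ 0, so it is zero.
  refine or_iff_not_imp_left.2 fun hP ↦ ⟨b.repr P 0 / b.repr N 0, ?_⟩
  refine sub_eq_zero.1 (hzero ?_ ?_)
  · simp [hN0]
  · simpa [hNN, hNP, g.symm x P N] using hP

end LorentzMetric

end

/-! ### Existence of isotropic frames -/

section

variable {m : ℕ} {M : Type*} [TopologicalSpace M]
  [ChartedSpace (EuclideanSpace ℝ (Fin (m + 2))) M] [IsManifold (𝓡 (m + 2)) ∞ M]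
  {V : Type*} [TopologicalSpace V]
  [ChartedSpace (EuclideanSpace ℝ (Fin (m + 1))) V]
  {g : LorentzMetric m M} {ι : V → M}

/-- The gradient of a defining function of a lightlike hypersurface is isotropic along it. -/
lemma LorentzMetric.val_self_eq_zero_of_lightlike {x : M} {N N₀ : TangentSpace (𝓡 (m + 2)) x}
    (hN : N ≠ 0) (hN₀ : N₀ ≠ 0) (hNN₀ : g.val x N N₀ = 0)
    (h : ∀ w, g.val x N w = 0 → g.val x N₀ w = 0) : g.val x N N = 0 := by
  obtain ⟨u, hu⟩ : ∃ u, g.val x N u ≠ 0 := by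
    by_contra! h0
    exact hN (g.eq_of_forall_val_eq fun u ↦ by simp [h0])
  -- N₀ annihilates the kernel of (N, ·), so the two are proportional; the factor is read off on a
  -- transversal u.
  have h1 : N₀ = (g.val x N₀ u / g.val x N u) • N := g.eq_of_forall_val_eq fun v ↦ by
    have h2 := h (v - (g.val x N v / g.val x N u) • u) (by simp [hu])
    simp only [map_sub, map_smul, smul_eq_mul] at h2
    simp only [map_smul, smul_apply, smul_eq_mul]
    rw [sub_eq_zero.1 h2]
    field_simp
  have h3 : g.val x N₀ u / g.val x N u ≠ 0 := fun h0 ↦ hN₀ (by rw [h1, h0, zero_smul])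
  rw [h1, map_smul, smul_eq_mul] at hNN₀
  exact (mul_eq_zero.1 hNN₀).resolve_left h3

/-- Assembling the fields `e_1, e_a, e_n` into one family. -/
def frameOf {A : Type*} (N : A) (E : Fin m → A) (L : A) : Fin (m + 2) → A :=
  Fin.cons N (Fin.snoc (α := fun _ ↦ A) E L)

lemma frameOf_mid {A : Type*} (N : A) (E : Fin m → A) (L : A) (a : Fin m) :
    frameOf N E L (midIdx a) = E a := by
  rw [midIdx, ← Fin.succ_castSucc]
  simp [frameOf]

lemma frameOf_last {A : Type*} (N : A) (E : Fin m → A) (L : A) :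
    frameOf N E L (Fin.last (m + 1)) = L := by
  rw [← Fin.succ_last]
  simp [frameOf]

/-- There are `m` linearly independent vectors orthogonal to both `N` and `L`. -/
lemma LorentzMetric.exists_orthogonal {x : M} {N L : TangentSpace (𝓡 (m + 2)) x}
    (hNN : g.val x N N = 0) (hNL : g.val x N L = -1) :
    ∃ w : Fin m → TangentSpace (𝓡 (m + 2)) x, LinearIndependent ℝ w ∧
      (∀ a, g.val x N (w a) = 0) ∧ ∀ a, g.val x L (w a) = 0 := by
  let H : Submodule ℝ (TangentSpace (𝓡 (m + 2)) x) :=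
    LinearMap.ker (g.val x N : TangentSpace (𝓡 (m + 2)) x →ₗ[ℝ] ℝ)
  let φ : H →ₗ[ℝ] ℝ := (g.val x L : TangentSpace (𝓡 (m + 2)) x →ₗ[ℝ] ℝ).comp H.subtype
  have h1 := Module.Dual.finrank_ker_add_one_of_ne_zero (K := ℝ)
    (f := (g.val x N : TangentSpace (𝓡 (m + 2)) x →ₗ[ℝ] ℝ)) (fun h0 ↦ by
      have h : g.val x N L = 0 := congrArg (fun T : _ →ₗ[ℝ] ℝ ↦ T L) h0
      norm_num [hNL] at h)
  have h2 := Module.Dual.finrank_ker_add_one_of_ne_zero (K := ℝ) (f := φ) (fun h0 ↦ by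
      have h : g.val x L N = 0 := congrArg (fun T : H →ₗ[ℝ] ℝ ↦ T ⟨N, hNN⟩) h0
      norm_num [g.symm x L N, hNL] at h)
  have h3 : Module.finrank ℝ (LinearMap.ker φ) = m := by
    rw [finrank_tangentSpace] at h1
    change Module.finrank ℝ H + 1 = _ at h1
    omega
  let b := Module.finBasisOfFinrankEq ℝ _ h3
  refine ⟨fun a ↦ (b a : H), ?_, fun a ↦ (b a : H).2, fun a ↦ (b a).2⟩
  exact (b.linearIndependent.map' (LinearMap.ker φ).subtype (Submodule.ker_subtype _)).map'
    H.subtype (Submodule.ker_subtype _)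

variable [IsManifold (𝓡 (m + 1)) ∞ V]

/-- Every point of a lightlike hypersurface lies in the domain of an isotropic frame field. -/
lemma IsLightlikeHypersurface.exists_isotropicFrame (hV : IsLightlikeHypersurface g ι) (p : V) :
    ∃ (W : Set V) (_ : IsotropicFrame g ι W), p ∈ W := by
  obtain ⟨f, hf, hfV⟩ := hV.isImmersion.exists_tangentHyperplane_eq_ker p
  obtain ⟨N, hN, hNf⟩ := g.exists_gradient hf
  have hι : ContinuousAt ι p := (hV.isImmersion.mdifferentiableAt p).continuousAt
  have hNV : ∀ᶠ q in 𝓝 p, N (ι q) ≠ 0 ∧ g.val (ι q) (N (ι q)) (N (ι q)) = 0 ∧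
      ∀ v, v ∈ tangentHyperplane ι q ↔ g.val (ι q) (N (ι q)) v = 0 := by
    filter_upwards [hfV, hι.eventually hNf] with q hq hNq
    have hmem (v) : v ∈ tangentHyperplane ι q ↔ g.val (ι q) (N (ι q)) v = 0 := by
      rw [hq.2.2, hNq]
    have hN0 : N (ι q) ≠ 0 := fun h0 ↦ hq.2.1 (by ext v; simpa [h0] using (hNq v).symm)
    obtain ⟨N₀, hN₀, hne, h⟩ := hV.lightlike q
    exact ⟨hN0, g.val_self_eq_zero_of_lightlike hN0 hne ((hmem _).1 hN₀)
      fun w hw ↦ h w ((hmem w).2 hw), hmem⟩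
  obtain ⟨hN0, hNN, -⟩ := hNV.self_of_nhds
  obtain ⟨u, hu⟩ : ∃ u, g.val (ι p) (N (ι p)) u ≠ 0 := by
    by_contra! h0
    exact hN0 (g.eq_of_forall_val_eq fun u ↦ by simp [h0])
  let S : Π y : M, TangentSpace (𝓡 (m + 2)) y := extend (EuclideanSpace ℝ (Fin (m + 2))) u
  have hS : FieldSmoothNear S (ι p) := .extend m u
  have hSp : S (ι p) = u := FiberBundle.extend_apply_self _ _
  let s (y : M) : ℝ := g.val y (N y) (S y)
  have hs : FunSmoothNear m s (ι p) := hN.metric hS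
  have hsp : s (ι p) ≠ 0 := by simpa [s, hSp] using hu
  -- A transversal field rescaled to (N, T) = -1.
  let T : Π y : M, TangentSpace (𝓡 (m + 2)) y := (fun y ↦ -1 * (s y)⁻¹) • S
  have hT : FieldSmoothNear T (ι p) := .smul ((FunSmoothNear.const (-1)).mul (hs.inv hsp)) hS
  have hNT : ∀ᶠ y in 𝓝 (ι p), g.val y (N y) (T y) = -1 := by
    filter_upwards [hs.mdifferentiableAt.continuousAt.eventually_ne hsp] with y hy
    simp only [T, Pi.smul_apply', map_smul, smul_eq_mul]
    exact (mul_assoc _ _ _).trans (by rw [inv_mul_cancel₀ hy, mul_one])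
  -- Where (N, N) = 0, adding ½ (T, T) N keeps (N, L) = -1 and makes L isotropic, as 2 · ½ (T, T)
  -- (T, N) = -(T, T).
  let L : Π y : M, TangentSpace (𝓡 (m + 2)) y := T + (fun y ↦ 2⁻¹ * g.val y (T y) (T y)) • N
  have hL : FieldSmoothNear L (ι p) :=
    hT.add (.smul ((FunSmoothNear.const 2⁻¹).mul (hT.metric hT)) hN)
  have hLV : ∀ y, g.val y (N y) (N y) = 0 → g.val y (N y) (T y) = -1 →
      g.val y (N y) (L y) = -1 ∧ g.val y (L y) (L y) = 0 := by
    intro y h1 h2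
    have h3 := (g.symm y (T y) (N y)).trans h2
    simp only [L, Pi.add_apply, Pi.smul_apply', map_add, map_smul, add_apply, smul_apply,
      smul_eq_mul, h1, h2, h3]
    constructor <;> ring
  obtain ⟨hNL, hLL⟩ := hLV _ hNN hNT.self_of_nhds
  obtain ⟨w, hw, hNw, hLw⟩ := g.exists_orthogonal hNN hNL
  let Y (a : Fin m) : Π y : M, TangentSpace (𝓡 (m + 2)) y :=
    extend (EuclideanSpace ℝ (Fin (m + 2))) (w a)
  have hY (a) : FieldSmoothNear (Y a) (ι p) := .extend m (w a)
  have hYp (a) : Y a (ι p) = w a := FiberBundle.extend_apply_self _ _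
  -- Projection to the orthogonal complement of N and L; the plus signs reflect (N, L) = -1. At p it
  -- fixes the vectors w a.
  let E (a : Fin m) : Π y : M, TangentSpace (𝓡 (m + 2)) y :=
    Y a + (fun y ↦ g.val y (N y) (Y a y)) • L + (fun y ↦ g.val y (L y) (Y a y)) • N
  have hE (a) : FieldSmoothNear (E a) (ι p) :=
    ((hY a).add (.smul (hN.metric (hY a)) hL)).add (.smul (hL.metric (hY a)) hN)
  have hEV (a) : ∀ y, g.val y (N y) (N y) = 0 → g.val y (N y) (T y) = -1 →
      g.val y (N y) (E a y) = 0 ∧ g.val y (L y) (E a y) = 0 := by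
    intro y h1 h2
    obtain ⟨h3, h4⟩ := hLV y h1 h2
    have h5 := (g.symm y (L y) (N y)).trans h3
    simp only [E, Pi.add_apply, Pi.smul_apply', map_add, map_smul, smul_eq_mul, h1, h3, h4, h5]
    constructor <;> ring
  have hEp (a) : E a (ι p) = w a := by simp [E, hYp, hNw, hLw]
  let e : Fin (m + 2) → Π y : M, TangentSpace (𝓡 (m + 2)) y := frameOf N E L
  have e0 : e 0 = N := rfl
  have ea (a) : e (midIdx a) = E a := frameOf_mid N E L a
  have en : e (Fin.last (m + 1)) = L := frameOf_last N E L
  have he (i) : FieldSmoothNear (e i) (ι p) := by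
    obtain rfl | ⟨a, rfl⟩ | rfl := eq_first_or_mid_or_last i
    · exact e0 ▸ hN
    · exact ea a ▸ hE a
    · exact en ▸ hL
  have hlip : LinearIndependent ℝ fun i ↦ e i (ι p) := by
    refine Fintype.linearIndependent_iff.2 fun c hc ↦ ?_
    rw [sum_univ_eq_first_mid_last, e0, en] at hc
    simp only [ea, hEp] at hc
    have h0 := congrArg (g.val (ι p) (L (ι p))) hc
    have hn := congrArg (g.val (ι p) (N (ι p))) hc
    simp only [map_add, map_sum, map_smul, smul_eq_mul, hNN, hNL, hLL, hNw, hLw,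
      g.symm (ι p) (L (ι p)) (N (ι p)), map_zero, mul_zero, Finset.sum_const_zero, zero_add,
      add_zero, mul_neg_one, neg_eq_zero] at h0 hn
    rw [h0, hn, zero_smul, zero_smul, zero_add, add_zero] at hc
    have hm := Fintype.linearIndependent_iff.1 hw _ hc
    intro i
    obtain rfl | ⟨a, rfl⟩ | rfl := eq_first_or_mid_or_last i
    exacts [h0, hm a, hn]
  have hli : ∀ᶠ y in 𝓝 (ι p), LinearIndependent ℝ fun i ↦ e i y := by
    have hG : FunSmoothNear m (fun y ↦ (g.gram fun i ↦ e i y).det) (ι p) :=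
      .det fun i j ↦ (he i).metric (he j)
    filter_upwards [hG.mdifferentiableAt.continuousAt.eventually_ne
      (g.linearIndependent_iff_gram.1 hlip)] with y hy using g.linearIndependent_iff_gram.2 hy
  obtain ⟨U, hU, hUo, hpU⟩ := mem_nhds_iff.1 (hli.and (eventually_all.2 he))
  obtain ⟨W, hW, hWo, hpW⟩ := mem_nhds_iff.1
    ((hι.eventually (hUo.mem_nhds hpU)).and ((hι.eventually hNT).and hNV))
  refine ⟨W, ⟨hWo, U, hUo, fun q hq ↦ (hW hq).1, e, ⟨fun hy ↦ (hU hy).1,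
    fun hy ↦ (LorentzMetric.span_eq_top (hU hy).1).ge,
    fun i y hy ↦ ((hU hy).2 i).contMDiffWithinAt⟩, ?_, ?_, ?_, ?_, ?_, ?_, ?_, ?_⟩, hpW⟩
  all_goals intro q hq
  all_goals obtain ⟨hqU, hqT, hq0, hqN, hqmem⟩ := hW hq
  · exact (hqmem _).2 hqN
  · intro a
    rw [ea]
    exact (hqmem _).2 (hEV a _ hqN hqT).1
  · exact hqN
  · rw [en]
    exact (hLV _ hqN hqT).2
  · rw [en]
    exact (hLV _ hqN hqT).1
  · intro a
    rw [ea]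
    exact (hEV a _ hqN hqT).1
  · intro a
    rw [ea, en]
    exact (hEV a _ hqN hqT).2
  · simp only [ea]
    refine Matrix.PosDef.of_dotProduct_mulVec_pos (Matrix.IsHermitian.ext fun a b ↦ ?_)
      fun c hc ↦ ?_
    · simpa using g.symm _ _ _
    · have hP : star c ⬝ᵥ (Matrix.of fun a b : Fin m ↦
          g.val (ι q) (E a (ι q)) (E b (ι q))).mulVec c =
          g.val (ι q) (∑ a, c a • E a (ι q)) (∑ a, c a • E a (ι q)) := by
        simp only [dotProduct, Matrix.mulVec, Finset.mul_sum, map_sum, map_smul, sum_apply,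
          smul_apply, smul_eq_mul, star_trivial, Matrix.of_apply]
        refine Finset.sum_congr rfl fun a _ ↦ Finset.sum_congr rfl fun b _ ↦ ?_
        rw [g.symm]
        ring
      rw [hP]
      refine (g.val_self_pos_or_eq_smul hq0 hqN
        (by simp [(hEV _ _ hqN hqT).1])).resolve_right ?_
      rintro ⟨k, hk⟩
      refine hc (funext fun a ↦ ?_)
      -- If x^a e_a = k e_1, then -k, x^a, 0 are coefficients of a linear relation of the frame, so
      -- all x^a vanish.
      have h := Fintype.linearIndependent_iff.1 (hU hqU).1 (frameOf (-k) c 0) (by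
        rw [sum_univ_eq_first_mid_last, e0]
        simp only [ea, frameOf_mid, frameOf_last, hk]
        simp [frameOf]) (midIdx a)
      rwa [frameOf_mid] at h

end

end

/-! ### The derivative formula and the equivalences -/

theorem theorem4 {m : ℕ} {M : Type*} [TopologicalSpace M] [T2Space M]
    [ChartedSpace (EuclideanSpace ℝ (Fin (m + 2))) M] [IsManifold (𝓡 (m + 2)) ∞ M]
    {V : Type*} [TopologicalSpace V] [T2Space V]
    [ChartedSpace (EuclideanSpace ℝ (Fin (m + 1))) V] [IsManifold (𝓡 (m + 1)) ∞ V]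
    (g : LorentzMetric m M)
    (D : CovariantDerivative (𝓡 (m + 2)) (EuclideanSpace ℝ (Fin (m + 2)))
      (TangentSpace (𝓡 (m + 2)) : M → Type _))
    (hD : IsLeviCivita g D) (ι : V → M) (hV : IsLightlikeHypersurface g ι) :
    (∀ (W : Set V) (F : IsotropicFrame g ι W), ∀ p ∈ W, ∀ X : TangentSpace (𝓡 (m + 1)) p,
      mfderiv (𝓡 (m + 1)) (𝓡 (m + 2)) ι p X = F.e 0 (ι p) →
        F.covDerivSecondFundamental D p X =
          secondOrderExpression (F.firstFundamental p) (F.secondFundamental D p)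
            - (2 : ℝ) • F.curvatureTerm D p) ∧
    (HasNullIsotropicSectionalCurvature g D ι ↔
      ∀ (W : Set V) (F : IsotropicFrame g ι W), ∀ p ∈ W, ∀ X : TangentSpace (𝓡 (m + 1)) p,
        mfderiv (𝓡 (m + 1)) (𝓡 (m + 2)) ι p X = F.e 0 (ι p) →
          F.covDerivSecondFundamental D p X =
            secondOrderExpression (F.firstFundamental p) (F.secondFundamental D p)) ∧
    (HasNullIsotropicSectionalCurvature g D ι ↔
      ∀ (W : Set V) (F : IsotropicFrame g ι W), ∀ p ∈ W, F.curvatureTerm D p = 0) := by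
  have formula : ∀ (W : Set V) (F : IsotropicFrame g ι W), ∀ p ∈ W,
      ∀ X : TangentSpace (𝓡 (m + 1)) p,
      mfderiv (𝓡 (m + 1)) (𝓡 (m + 2)) ι p X = F.e 0 (ι p) →
        F.covDerivSecondFundamental D p X =
          secondOrderExpression (F.firstFundamental p) (F.secondFundamental D p)
            - (2 : ℝ) • F.curvatureTerm D p :=
    fun W F p hp X hX ↦ F.covDerivSecondFundamental_eq hD hV.isImmersion hp hX
  have hiff : HasNullIsotropicSectionalCurvature g D ι ↔
      ∀ (W : Set V) (F : IsotropicFrame g ι W), ∀ p ∈ W, F.curvatureTerm D p = 0 := by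
    refine ⟨fun h W F p hp ↦ F.curvatureTerm_eq_zero hD hV.isImmersion h hp,
      fun h p σ hσ _ N hN _ hNN P hP _ ↦ ?_⟩
    -- One frame at p decides every isotropic plane tangent there.
    obtain ⟨W, F, hp⟩ := hV.exists_isotropicFrame p
    exact F.isotropicSectionalCurvature_eq_zero hD (hV.isImmersion.mfderiv_injective p) hp
      (h W F p hp) (hσ hN) hNN (hσ hP)
  refine ⟨formula, hiff.trans ⟨fun h W F p hp X hX ↦ ?_, fun h W F p hp ↦ ?_⟩, hiff⟩
  · rw [formula W F p hp X hX, h W F p hp, smul_zero, sub_zero]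
  -- Condition (ii) speaks of X with dι(X) = e_1; tangency of e_1 provides one.
  · obtain ⟨X, hX⟩ := F.first_mem p hp
    have h1 := formula W F p hp X hX
    rw [h W F p hp X hX, eq_comm, sub_eq_self, smul_eq_zero_iff_right two_ne_zero] at h1
    exact h1
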